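/- Let $M=(M,\mu)$ be a $\sigma$-finite measure space; all scalars are real. A measurable pseudometric on $M$ is a map $\rho$ assigning to each pair of positive measure sets (modulo null sets) a value in $[0,\infty]$ such that $\rho(A,A)=0$, $\rho(A,B)=\rho(B,A)$, $\rho(\bigcup_n A_n,B)=\inf_n\rho(A_n,B)$ and $\rho(A,C)\le\sup_{B'\subset B}(\rho(A,B')+\rho(B',C))$. For $f\in L^\infty(M)$ let $\rho_f(A,B)$ be the distance between the essential ranges of $f|_A$ and $f|_B$, let $L(f)=\sup\{\rho_f(A,B)/\rho(A,B):\rho(A,B)>0\}$, and let $\mathrm{Lip}(M)=\{f\in L^\infty(M): L(f)<\infty\}$ with norm $\max(L(f),\|f\|_\infty)$; it is a dual Banach space whose weak* topology agrees on the unit ball with that of $L^\infty(M)=L^1(M)^*$. Assume that $\rho$ is a measurable metric, i.e. that $\mathrm{Lip}(M)$ is weak*-dense in $L^\infty(M)$. An $L^\infty(M)$-normed module is a Banach module $E$ over $L^\infty(M)$ with a map $|\cdot|:E\to L^\infty(M)$ (necessarily unique) such that $|\phi|\ge 0$, $\|\phi\|=\|\,|\phi|\,\|_\infty$ and $|f\phi|=|f||\phi|$.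 It is an abelian W*-module if it is moreover a dual Banach space such that the product $L^\infty(M)\times E\to E$ is separately weak*-continuous. The dual module $E'$ is the Banach module of bounded $L^\infty(M)$-module homomorphisms $E\to L^\infty(M)$, and $E$ is reflexive if the natural map $E\to E''$ is onto. A Hilbert module is a Banach module $E$ with a symmetric, $L^\infty(M)$-bilinear, positive inner product $\langle\cdot,\cdot\rangle:E\times E\to L^\infty(M)$ with $\|\phi\|^2=\|\langle\phi,\phi\rangle\|_\infty$; it is self-dual if every element of $E'$ is of the form $\langle\cdot,\psi\rangle$ with $\psi\in E$. Let $\mathcal X(M)$ (measurable vector fields) be the module of all bounded weak*-continuous linear maps $\delta:\mathrm{Lip}(M)\to L^\infty(M)$ with $\delta(fg)=f\delta(g)+\delta(f)g$, with the operator norm and $(h\delta)(f)=h\,\delta(f)$ for $h\in L^\infty(M)$; it is an $L^\infty(M)$-normed module. Let $\Omega(M)=\mathcal X(M)'$ (measurable 1-forms). (a) If $\Omega(M)$ is reflexive, then $\mathcal X(M)$ is an abelian W*-module. (b) If $\mathcal X(M)$ is finitely generated, then $\Omega(M)$ is reflexive, and hence $\mathcal X(M)$ is an abelian W*-module. Here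 finitely generated means that there are finitely many elements of $\mathcal X(M)$ whose $L^\infty(M)$-linear span is dense in $\mathcal X(M)$ for the topology of pointwise weak* convergence ($\delta_i\to\delta$ if and only if $\delta_i(f)\to\delta(f)$ weak* in $L^\infty(M)$ for every $f\in\mathrm{Lip}(M)$); this holds in particular if $\mathcal X(M)$ is algebraically finitely generated over $L^\infty(M)$. (c) If $\mathcal X(M)$ satisfies the parallelogram law $|\phi+\psi|^2+|\phi-\psi|^2=2|\phi|^2+2|\psi|^2$ almost everywhere for all $\phi,\psi\in\mathcal X(M)$, then $\Omega(M)$ is reflexive, and hence $\mathcal X(M)$ is an abelian W*-module. Moreover $\mathcal X(M)$ and $\Omega(M)$ are then canonically isomorphic self-dual Hilbert modules: there are inner products which make $\mathcal X(M)$ and $\Omega(M)$, with their given norms, self-dual Hilbert modules, and $\psi\mapsto\langle\cdot,\psi\rangle$ is an isometric $L^\infty(M)$-linear bijection of $\mathcal X(M)$ onto $\Omega(M)$ which preserves the inner products. -/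

import Mathlib

open MeasureTheory Topology Set
open scoped ENNReal NNReal

universe u

noncomputable section

/-! ### The real Banach algebra `L^∞` -/

/-- The real Banach space `L^∞(X, μ)`. -/
abbrev Linf {X : Type u} [MeasurableSpace X] (μ : Measure X) : Type u := Lp ℝ ∞ μ

namespace Linf

variable {X : Type u} [MeasurableSpace X] {μ : Measure X}

theorem memLp_mul (f g : Linf μ) : MemLp (fun x => f x * g x) ∞ μ := by
  simpa [Pi.mul_def] using! (Lp.memLp g).mul (r := ∞) (Lp.memLp f)

/-- Pointwise almost everywhere multiplication. -/
instance instMul : Mul (Linf μ) := ⟨fun f g => (memLp_mul f g).toLp _⟩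

/-- The constant function `1`. -/
instance instOne : One (Linf μ) := ⟨(memLp_top_const (1 : ℝ)).toLp _⟩

theorem coeFn_mul (f g : Linf μ) : ⇑(f * g) =ᵐ[μ] fun x => f x * g x :=
  MemLp.coeFn_toLp (memLp_mul f g)

theorem coeFn_one : ⇑(1 : Linf μ) =ᵐ[μ] fun _ => (1 : ℝ) :=
  MemLp.coeFn_toLp (memLp_top_const (1 : ℝ))

theorem mul_comm' (f g : Linf μ) : f * g = g * f := by
  apply Lp.ext
  filter_upwards [coeFn_mul f g, coeFn_mul g f] with x h1 h2
  rw [h1, h2, mul_comm]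

theorem mul_assoc' (f g h : Linf μ) : f * g * h = f * (g * h) := by
  apply Lp.ext
  filter_upwards [coeFn_mul (f * g) h, coeFn_mul f (g * h), coeFn_mul f g, coeFn_mul g h]
    with x h1 h2 h3 h4
  rw [h1, h2, h3, h4, mul_assoc]

theorem one_mul' (f : Linf μ) : 1 * f = f := by
  apply Lp.ext
  filter_upwards [coeFn_mul 1 f, coeFn_one (μ := μ)] with x h1 h2
  rw [h1, h2, one_mul]

theorem mul_add' (f g h : Linf μ) : f * (g + h) = f * g + f * h := by
  apply Lp.ext
  filter_upwards [coeFn_mul f (g + h), coeFn_mul f g, coeFn_mul f h, Lp.coeFn_add g h,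
    Lp.coeFn_add (f * g) (f * h)] with x h1 h2 h3 h4 h5
  simp only [h1, h5, h4, Pi.add_apply, h2, h3, mul_add]

theorem zero_mul' (f : Linf μ) : 0 * f = 0 := by
  apply Lp.ext
  filter_upwards [coeFn_mul 0 f, Lp.coeFn_zero ℝ ∞ μ] with x h1 h2
  rw [h1, h2, Pi.zero_apply, zero_mul]

theorem smul_mul' (c : ℝ) (f g : Linf μ) : (c • f) * g = c • (f * g) := by
  apply Lp.ext
  filter_upwards [coeFn_mul (c • f) g, Lp.coeFn_smul c f, Lp.coeFn_smul c (f * g),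
    coeFn_mul f g] with x h1 h2 h3 h4
  simp only [h1, h2, h3, Pi.smul_apply, h4, smul_eq_mul, mul_assoc]

theorem norm_mul_le' (f g : Linf μ) : ‖f * g‖ ≤ ‖f‖ * ‖g‖ := by
  have h := Lp.norm_smul_le (r := ∞) f g
  have e : (f • g : Lp ℝ ∞ μ) = f * g := by
    apply Lp.ext
    filter_upwards [Lp.coeFn_lpSMul (r := ∞) f g, coeFn_mul f g] with x h1 h2
    rw [h1, h2]; rfl
  have e2 := congrArg norm e
  exact e2 ▸ h

/-- `L^∞(X, μ)` is a commutative Banach ring under almost everywhere pointwise operations. -/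
instance instNormedCommRing : NormedCommRing (Linf μ) :=
  { (inferInstance : NormedAddCommGroup (Linf μ)), instMul (μ := μ), instOne (μ := μ) with
    mul_assoc := mul_assoc'
    mul_comm := mul_comm'
    one_mul := one_mul'
    mul_one := fun f => by rw [mul_comm', one_mul']
    left_distrib := mul_add'
    right_distrib := fun f g h => by rw [mul_comm', mul_add', mul_comm' h f, mul_comm' h g]
    zero_mul := zero_mul'
    mul_zero := fun f => by rw [mul_comm', zero_mul']
    norm_mul_le := norm_mul_le' }

instance instAlgebra : Algebra ℝ (Linf μ) :=
  Algebra.ofModule smul_mul' fun c f g => by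
    rw [mul_comm', smul_mul', mul_comm']

instance instNormedAlgebra : NormedAlgebra ℝ (Linf μ) :=
  { instAlgebra (μ := μ) with norm_smul_le := fun c f => norm_smul_le c f }

/-- The weak* topology of `L^∞(X, μ)` as the dual of `L^1(X, μ)`. -/
@[reducible] def weakStar (μ : Measure X) : TopologicalSpace (Linf μ) :=
  TopologicalSpace.induced (fun (f : Linf μ) (g : Lp ℝ 1 μ) => ∫ x, f x * g x ∂μ) inferInstance

theorem continuous_weakStar_iff {T : Type*} [TopologicalSpace T] {F : T → Linf μ} :
    @Continuous _ _ _ (weakStar μ) F ↔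
      ∀ g : Lp ℝ 1 μ, Continuous fun t => ∫ x, F t x * g x ∂μ := by
  rw [continuous_induced_rng, continuous_pi_iff]
  rfl

theorem integrable_mul (f : Linf μ) (g : Lp ℝ 1 μ) : Integrable (fun x => f x * g x) μ := by
  have h := (Lp.memLp g).mul (r := 1) (Lp.memLp f)
  exact memLp_one_iff_integrable.1 (by simpa [Pi.mul_def] using! h)

/-- The essential range of the restriction of `f` to `A`. -/
def essRange (f : Linf μ) (A : Set X) : Set ℝ :=
  {a | ∀ U ∈ 𝓝 a, 0 < μ (A ∩ f ⁻¹' U)}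

/-- The distance in `ℝ` between the essential ranges of `f` on `A` and on `B`. -/
def essDist (f : Linf μ) (A B : Set X) : ℝ≥0∞ :=
  ⨅ a ∈ essRange f A, ⨅ b ∈ essRange f B, edist a b

end Linf

/-! ### Measurable pseudometrics and Lipschitz numbers -/

/-- Measurable sets of positive measure. -/
def IsPositiveSet {X : Type u} [MeasurableSpace X] (μ : Measure X) (A : Set X) : Prop :=
  MeasurableSet A ∧ 0 < μ A

/-- A measurable pseudometric, i.e. an extended distance between positive measure sets modulo
null sets (only the values at positive measure sets matter). -/
structure MeasurablePseudometric {X : Type u} [MeasurableSpace X] (μ : Measure X) where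
  /-- the distance between two positive measure sets -/
  rho : Set X → Set X → ℝ≥0∞
  congr : ∀ A A' B B', IsPositiveSet μ A → IsPositiveSet μ A' → IsPositiveSet μ B →
    IsPositiveSet μ B' → A =ᵐ[μ] A' → B =ᵐ[μ] B' → rho A B = rho A' B'
  self : ∀ A, IsPositiveSet μ A → rho A A = 0
  symm : ∀ A B, IsPositiveSet μ A → IsPositiveSet μ B → rho A B = rho B A
  iUnion : ∀ (A : ℕ → Set X) (B : Set X), (∀ n, IsPositiveSet μ (A n)) → IsPositiveSet μ B →
    rho (⋃ n, A n) B = ⨅ n, rho (A n) B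
  triangle : ∀ A B C, IsPositiveSet μ A → IsPositiveSet μ B → IsPositiveSet μ C →
    rho A C ≤ ⨆ (B' : Set X) (_ : IsPositiveSet μ B') (_ : B' ⊆ B), (rho A B' + rho B' C)

namespace MeasurablePseudometric

variable {X : Type u} [MeasurableSpace X] {μ : Measure X}

/-- The Lipschitz number
`L(f) = sup {ρ_f(A, B) / ρ(A, B) : A, B of positive measure and ρ(A, B) > 0}`. -/
def lipNumber (d : MeasurablePseudometric μ) (f : Linf μ) : ℝ≥0∞ :=
  ⨆ (A : Set X) (B : Set X) (_ : IsPositiveSet μ A) (_ : IsPositiveSet μ B)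
    (_ : 0 < d.rho A B), Linf.essDist f A B / d.rho A B

theorem ae_mem_essRange (f : Linf μ) (A : Set X) (hA : MeasurableSet A) :
    ∀ᵐ x ∂μ, x ∈ A → f x ∈ Linf.essRange f A := by
  have hf : Measurable f := (Lp.stronglyMeasurable f).measurable
  have h := (Measure.support_mem_ae (μ := (μ.restrict A).map f))
  rw [← ae_restrict_iff' hA]
  have h2 := ae_of_ae_map hf.aemeasurable h
  filter_upwards [h2] with x hx
  intro U hU
  obtain ⟨V, hVU, hVo, hxV⟩ := mem_nhds_iff.1 hU
  have h3 := (Measure.mem_support_iff_forall (f x)).1 hx V (hVo.mem_nhds hxV)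
  rw [Measure.map_apply hf hVo.measurableSet,
    Measure.restrict_apply (hf hVo.measurableSet), inter_comm] at h3
  exact h3.trans_le (measure_mono (inter_subset_inter_right _ (preimage_mono hVU)))

theorem exists_small_subset (d : MeasurablePseudometric μ) {A B : Set X}
    (hA : IsPositiveSet μ A) (hB : IsPositiveSet μ B) {t : ℝ≥0∞} (ht : d.rho A B < t)
    {ι : Type} [Countable ι] (S : ι → Set X) (hS : ∀ i, MeasurableSet (S i))
    (hcov : ⋃ i, S i = univ) :
    ∃ i, IsPositiveSet μ (A ∩ S i) ∧ d.rho (A ∩ S i) B < t := by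
  let J := {i : ι // 0 < μ (A ∩ S i)}
  have hnull : μ (⋃ i : {i : ι // ¬ 0 < μ (A ∩ S i)}, A ∩ S i.1) = 0 := by
    rw [measure_iUnion_null_iff]
    intro i
    simpa using i.2
  have hAe : (⋃ i : J, A ∩ S i.1) =ᵐ[μ] A := by
    refine Filter.EventuallyLE.antisymm ?_ ?_
    · exact Filter.Eventually.of_forall fun x hx => by
        obtain ⟨i, hi⟩ := mem_iUnion.1 hx
        exact hi.1
    · rw [ae_le_set]
      refine measure_mono_null ?_ hnull
      rintro x ⟨hxA, hx⟩
      obtain ⟨i, hi⟩ := mem_iUnion.1 (hcov.symm ▸ mem_univ x : x ∈ ⋃ i, S i)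
      by_cases hp : 0 < μ (A ∩ S i)
      · exact (hx (mem_iUnion.2 ⟨⟨i, hp⟩, hxA, hi⟩)).elim
      · exact mem_iUnion.2 ⟨⟨i, hp⟩, hxA, hi⟩
  have hpos : 0 < μ (⋃ i : J, A ∩ S i.1) := by rw [measure_congr hAe]; exact hA.2
  have hJ : Nonempty J := by
    by_contra hJ
    rw [not_nonempty_iff] at hJ
    simp at hpos
  obtain ⟨e, he⟩ := exists_surjective_nat J
  have hU : (⋃ n, A ∩ S (e n).1) = ⋃ i : J, A ∩ S i.1 := he.iUnion_comp fun i : J => A ∩ S i.1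
  have hP : ∀ n, IsPositiveSet μ (A ∩ S (e n).1) := fun n => ⟨hA.1.inter (hS _), (e n).2⟩
  have h1 := d.iUnion (fun n => A ∩ S (e n).1) B hP hB
  have h2 : d.rho (⋃ n, A ∩ S (e n).1) B = d.rho A B := by
    rw [hU]
    exact d.congr _ _ _ _ ⟨MeasurableSet.iUnion fun i => hA.1.inter (hS _), hpos⟩ hA hB hB hAe
      (ae_eq_refl _)
  rw [← h2, h1, iInf_lt_iff] at ht
  obtain ⟨n, hn⟩ := ht
  exact ⟨_, hP n, hn⟩

theorem rho_mono_left (d : MeasurablePseudometric μ) {A A' B : Set X} (hA : IsPositiveSet μ A)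
    (hA' : IsPositiveSet μ A') (hB : IsPositiveSet μ B) (h : A' ⊆ A) :
    d.rho A B ≤ d.rho A' B := by
  have h1 := d.iUnion (fun n => if n = 0 then A' else A) B
    (fun n => by split_ifs <;> assumption) hB
  have h2 : (⋃ n : ℕ, if n = 0 then A' else A) = A := by
    apply subset_antisymm
    · refine iUnion_subset fun n => ?_
      split_ifs
      exacts [h, subset_rfl]
    · exact subset_iUnion_of_subset 1 (by simp)
  rw [h2] at h1
  rw [h1]
  exact (iInf_le _ 0).trans (by simp)

theorem abs_sub_le_of_mem_essRange (f : Linf μ) {A : Set X} {ε : ℝ}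
    (h : ∀ x ∈ A, ∀ y ∈ A, |f x - f y| ≤ ε) {a : ℝ} (ha : a ∈ Linf.essRange f A) {x : X}
    (hx : x ∈ A) : |f x - a| ≤ ε := by
  refine le_of_forall_pos_le_add fun η hη => ?_
  obtain ⟨y, hyA, hy⟩ := nonempty_of_measure_ne_zero (ha _ (Metric.ball_mem_nhds a hη)).ne'
  have h1 := h x hx y hyA
  rw [mem_preimage, Metric.mem_ball, Real.dist_eq] at hy
  calc |f x - a| = |(f x - f y) + (f y - a)| := by ring_nf
    _ ≤ |f x - f y| + |f y - a| := abs_add_le _ _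
    _ ≤ ε + η := by linarith

theorem edist_le_essDist (f : Linf μ) {A B : Set X} {ε : ℝ≥0}
    (hA : ∀ x ∈ A, ∀ y ∈ A, |f x - f y| ≤ ε) (hB : ∀ x ∈ B, ∀ y ∈ B, |f x - f y| ≤ ε) {x y : X}
    (hx : x ∈ A) (hy : y ∈ B) : edist (f x) (f y) ≤ Linf.essDist f A B + 2 * ε := by
  rw [← tsub_le_iff_right]
  refine le_iInf₂ fun a ha => le_iInf₂ fun b hb => ?_
  rw [tsub_le_iff_right]
  have h1 := abs_sub_le_of_mem_essRange f hA ha hx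
  have h2 := abs_sub_le_of_mem_essRange f hB hb hy
  have h1' : edist (f x) a ≤ ε := by
    rw [edist_dist, Real.dist_eq]; exact ENNReal.ofReal_le_of_le_toReal (by simpa using h1)
  have h2' : edist b (f y) ≤ ε := by
    rw [edist_comm, edist_dist, Real.dist_eq]
    exact ENNReal.ofReal_le_of_le_toReal (by simpa using h2)
  calc edist (f x) (f y) ≤ edist (f x) a + edist a b + edist b (f y) := edist_triangle4 _ _ _ _
    _ ≤ ε + edist a b + ε := by gcongr
    _ = edist a b + 2 * ε := by ring

theorem essDist_le_lipNumber_mul (d : MeasurablePseudometric μ) (f : Linf μ) {A B : Set X}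
    (hA : IsPositiveSet μ A) (hB : IsPositiveSet μ B) (h0 : 0 < d.rho A B)
    {t : ℝ≥0∞} (ht : d.rho A B < t) : Linf.essDist f A B ≤ d.lipNumber f * t := by
  have h : Linf.essDist f A B / d.rho A B ≤ d.lipNumber f :=
    le_iSup_of_le A <| le_iSup_of_le B <| le_iSup_of_le hA <| le_iSup_of_le hB <|
      le_iSup_of_le h0 le_rfl
  rw [ENNReal.div_le_iff h0.ne' ht.ne_top] at h
  exact h.trans (by gcongr)

/-- The estimate behind the algebraic stability of the Lipschitz functions. -/
theorem lipNumber_le (d : MeasurablePseudometric μ) (f g h : Linf μ) (C D : ℝ≥0)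
    (H : ∃ S ∈ ae μ, ∀ x ∈ S, ∀ y ∈ S,
      edist (h x) (h y) ≤ C * edist (f x) (f y) + D * edist (g x) (g y)) :
    d.lipNumber h ≤ C * d.lipNumber f + D * d.lipNumber g := by
  obtain ⟨S, hS, H⟩ := H
  set K : ℝ≥0∞ := C * d.lipNumber f + D * d.lipNumber g with hK
  rcases eq_or_ne K ∞ with hKt | hKt
  · rw [hKt]; exact le_top
  refine iSup_le fun A => iSup_le fun B => iSup_le fun hA => iSup_le fun hB =>
    iSup_le fun h0 => ?_
  rcases eq_or_ne (d.rho A B) ∞ with hT | hT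
  · rw [hT, ENNReal.div_top]; exact zero_le
  rw [ENNReal.div_le_iff h0.ne' hT]
  have key : ∀ ε : ℝ≥0, 0 < ε →
      Linf.essDist h A B ≤ K * d.rho A B + (K + 2 * C + 2 * D) * ε := by
    intro ε hε
    set t : ℝ≥0∞ := d.rho A B + ε with ht
    have htr : d.rho A B < t := ENNReal.lt_add_right hT (by exact_mod_cast hε.ne')
    let cell : ℤ × ℤ → Set X := fun n => {x | ⌊f x / ε⌋ = n.1 ∧ ⌊g x / ε⌋ = n.2}
    have hfm : Measurable f := (Lp.stronglyMeasurable f).measurable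
    have hgm : Measurable g := (Lp.stronglyMeasurable g).measurable
    have hcm : ∀ n, MeasurableSet (cell n) := fun n =>
      ((Int.measurable_floor.comp (hfm.div_const _)) (measurableSet_singleton n.1)).inter
        ((Int.measurable_floor.comp (hgm.div_const _)) (measurableSet_singleton n.2))
    have hcov : ⋃ n, cell n = univ :=
      eq_univ_of_forall fun x => mem_iUnion.2 ⟨(⌊f x / ε⌋, ⌊g x / ε⌋), rfl, rfl⟩
    have hfl : ∀ a b : ℝ, ⌊a / ε⌋ = ⌊b / ε⌋ → |a - b| ≤ ε := by
      intro a b hab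
      have h1 := (Int.abs_sub_lt_one_of_floor_eq_floor hab).le
      rwa [← sub_div, abs_div, abs_of_pos (by exact_mod_cast hε : (0 : ℝ) < ε),
        div_le_one (by exact_mod_cast hε)] at h1
    obtain ⟨i, hA', hi⟩ := d.exists_small_subset hA hB htr cell hcm hcov
    rw [d.symm _ _ hA' hB] at hi
    obtain ⟨j, hB', hj⟩ := d.exists_small_subset hB hA' hi cell hcm hcov
    rw [d.symm _ _ hB' hA'] at hj
    set A' := A ∩ cell i
    set B' := B ∩ cell j
    have h0' : 0 < d.rho A' B' := by
      refine h0.trans_le ((d.rho_mono_left hA hA' hB inter_subset_left).trans ?_)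
      rw [d.symm _ _ hA' hB, d.symm _ _ hA' hB']
      exact d.rho_mono_left hB hB' hA' inter_subset_left
    have hex : ∀ E, IsPositiveSet μ E → ∃ x ∈ E, x ∈ S ∧ h x ∈ Linf.essRange h E := by
      intro E hE
      have h1 : ∃ᵐ x ∂μ, x ∈ E := by
        rw [frequently_ae_mem_iff]; exact hE.2.ne'
      obtain ⟨x, hx, hx2, hx3⟩ := (h1.and_eventually
        ((ae_mem_essRange h E hE.1).and hS)).exists
      exact ⟨x, hx, hx3, hx2 hx⟩
    obtain ⟨x, hx, hxS, hxr⟩ := hex A' hA'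
    obtain ⟨y, hy, hyS, hyr⟩ := hex B' hB'
    have hmono : ∀ {E E' : Set X}, E' ⊆ E → Linf.essRange h E' ⊆ Linf.essRange h E :=
      fun hE a ha U hU => (ha U hU).trans_le (measure_mono (inter_subset_inter_left _ hE))
    have hf1 : edist (f x) (f y) ≤ d.lipNumber f * t + 2 * ε :=
      (edist_le_essDist f (fun x hx y hy => hfl _ _ (hx.2.1.trans hy.2.1.symm))
        (fun x hx y hy => hfl _ _ (hx.2.1.trans hy.2.1.symm)) hx hy).trans
        (by gcongr; exact d.essDist_le_lipNumber_mul f hA' hB' h0' hj)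
    have hg1 : edist (g x) (g y) ≤ d.lipNumber g * t + 2 * ε :=
      (edist_le_essDist g (fun x hx y hy => hfl _ _ (hx.2.2.trans hy.2.2.symm))
        (fun x hx y hy => hfl _ _ (hx.2.2.trans hy.2.2.symm)) hx hy).trans
        (by gcongr; exact d.essDist_le_lipNumber_mul g hA' hB' h0' hj)
    calc Linf.essDist h A B ≤ edist (h x) (h y) :=
          iInf₂_le_of_le _ (hmono inter_subset_left hxr) <|
            iInf₂_le_of_le _ (hmono inter_subset_left hyr) le_rfl
      _ ≤ C * edist (f x) (f y) + D * edist (g x) (g y) := H x hxS y hyS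
      _ ≤ C * (d.lipNumber f * t + 2 * ε) + D * (d.lipNumber g * t + 2 * ε) := by gcongr
      _ = K * t + (2 * C + 2 * D) * ε := by rw [hK]; ring
      _ = K * d.rho A B + (K + 2 * C + 2 * D) * ε := by rw [ht]; ring
  have hM : K + 2 * C + 2 * D ≠ ∞ := by finiteness
  have hlim : Filter.Tendsto (fun ε : ℝ≥0 => K * d.rho A B + (K + 2 * C + 2 * D) * (ε : ℝ≥0∞))
      (𝓝[>] 0) (𝓝 (K * d.rho A B + (K + 2 * C + 2 * D) * ((0 : ℝ≥0) : ℝ≥0∞))) := by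
    refine (tendsto_const_nhds.add (ENNReal.Tendsto.const_mul ?_ (Or.inr hM))).mono_left
      nhdsWithin_le_nhds
    exact ENNReal.continuous_coe.tendsto 0
  have := ge_of_tendsto hlim (Filter.eventually_of_mem self_mem_nhdsWithin fun ε hε => key ε hε)
  simpa using this

/-! ### The Lipschitz algebra -/

theorem lipNumber_add_le (d : MeasurablePseudometric μ) (f g : Linf μ) :
    d.lipNumber (f + g) ≤ d.lipNumber f + d.lipNumber g := by
  have := d.lipNumber_le f g (f + g) 1 1
    ⟨_, Lp.coeFn_add f g, fun x hx y hy => by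
      rw [mem_ofPred_eq] at hx hy
      rw [hx, hy, Pi.add_apply, Pi.add_apply, ENNReal.coe_one, one_mul, one_mul]
      exact edist_add_add_le _ _ _ _⟩
  simpa using this

theorem lipNumber_smul_le (d : MeasurablePseudometric μ) (c : ℝ) (f : Linf μ) :
    d.lipNumber (c • f) ≤ ‖c‖₊ * d.lipNumber f := by
  have := d.lipNumber_le f f (c • f) ‖c‖₊ 0
    ⟨_, Lp.coeFn_smul c f, fun x hx y hy => by
      rw [mem_ofPred_eq] at hx hy
      rw [hx, hy, Pi.smul_apply, Pi.smul_apply, edist_smul₀]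
      simp [ENNReal.smul_def]⟩
  simpa using this

theorem lipNumber_one (d : MeasurablePseudometric μ) : d.lipNumber 1 = 0 := by
  have := d.lipNumber_le 1 1 1 0 0
    ⟨_, Linf.coeFn_one, fun x hx y hy => by
      rw [mem_ofPred_eq] at hx hy
      rw [hx, hy, edist_self]
      exact zero_le⟩
  simpa using this

theorem lipNumber_mul_le (d : MeasurablePseudometric μ) (f g : Linf μ) :
    d.lipNumber (f * g) ≤ ‖g‖₊ * d.lipNumber f + ‖f‖₊ * d.lipNumber g := by
  have hb : ∀ u : Linf μ, ∀ᵐ x ∂μ, |u x| ≤ ‖u‖ := fun u => by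
    have h1 := ae_le_eLpNormEssSup (f := u) (μ := μ)
    filter_upwards [h1] with x hx
    have h2 : ‖u x‖ₑ ≤ ‖u‖ₑ := by
      rw [Lp.enorm_def, eLpNorm_exponent_top]; exact hx
    rw [← Real.norm_eq_abs]
    exact enorm_le_iff_norm_le.1 h2
  refine d.lipNumber_le f g (f * g) ‖g‖₊ ‖f‖₊
    ⟨_, (Linf.coeFn_mul f g).and ((hb f).and (hb g)), fun x hx y hy => ?_⟩
  obtain ⟨hx, hxf, hxg⟩ := hx
  obtain ⟨hy, hyf, hyg⟩ := hy
  rw [hx, hy]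
  simp only [edist_nndist]
  norm_cast
  rw [← NNReal.coe_le_coe]
  push_cast
  simp only [Real.dist_eq]
  calc |f x * g x - f y * g y| = |g x * (f x - f y) + f y * (g x - g y)| := by ring_nf
    _ ≤ |g x| * |f x - f y| + |f y| * |g x - g y| := by
      rw [← abs_mul, ← abs_mul]; exact abs_add_le _ _
    _ ≤ _ := by gcongr

/-- `Lip(M)`: the elements of `L^∞` with finite Lipschitz number. -/
def lipSubalgebra (d : MeasurablePseudometric μ) : Subalgebra ℝ (Linf μ) where
  carrier := {f | d.lipNumber f < ∞}
  mul_mem' {f g} hf hg := (d.lipNumber_mul_le f g).trans_lt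
    (ENNReal.add_lt_top.2 ⟨ENNReal.mul_lt_top ENNReal.coe_lt_top hf,
      ENNReal.mul_lt_top ENNReal.coe_lt_top hg⟩)
  add_mem' {f g} hf hg := (d.lipNumber_add_le f g).trans_lt (ENNReal.add_lt_top.2 ⟨hf, hg⟩)
  algebraMap_mem' r := by
    rw [mem_ofPred_eq, Algebra.algebraMap_eq_smul_one]
    exact (d.lipNumber_smul_le r 1).trans_lt (by simp [d.lipNumber_one])

/-- A measurable metric is a measurable pseudometric for which `Lip(M)` is weak*-dense in
`L^∞`. -/
def IsMeasurableMetric (d : MeasurablePseudometric μ) : Prop :=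
  @Dense (Linf μ) (Linf.weakStar μ) (d.lipSubalgebra : Set (Linf μ))

/-- `Lip(M)` as a type of its own, to be given the norm `max (L(f), ‖f‖_∞)`. -/
def Lip (d : MeasurablePseudometric μ) : Type u := d.lipSubalgebra

namespace Lip

variable {d : MeasurablePseudometric μ}

instance : CommRing (Lip d) := inferInstanceAs (CommRing d.lipSubalgebra)

instance : Algebra ℝ (Lip d) := inferInstanceAs (Algebra ℝ d.lipSubalgebra)

/-- The inclusion of `Lip(M)` into `L^∞`. -/
def incl (d : MeasurablePseudometric μ) : Lip d →ₐ[ℝ] Linf μ := d.lipSubalgebra.val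

theorem lipNumber_lt_top (f : Lip d) : d.lipNumber (incl d f) < ∞ := f.2

instance : Norm (Lip d) := ⟨fun f => max (d.lipNumber (incl d f)).toReal ‖incl d f‖⟩

theorem norm_def (f : Lip d) : ‖f‖ = max (d.lipNumber (incl d f)).toReal ‖incl d f‖ := rfl

theorem norm_smul_le' (c : ℝ) (f : Lip d) : ‖c • f‖ ≤ ‖c‖ * ‖f‖ := by
  rw [norm_def, norm_def, map_smul, mul_max_of_nonneg _ _ (norm_nonneg c)]
  refine max_le_max ?_ (norm_smul_le _ _)
  have := ENNReal.toReal_mono (ENNReal.mul_ne_top ENNReal.coe_ne_top f.lipNumber_lt_top.ne)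
    (d.lipNumber_smul_le c (incl d f))
  simpa using this

theorem normCore (d : MeasurablePseudometric μ) : NormedSpace.Core ℝ (Lip d) where
  norm_nonneg f := le_max_of_le_right (norm_nonneg _)
  norm_smul c f := by
    refine le_antisymm (norm_smul_le' c f) ?_
    rcases eq_or_ne c 0 with rfl | hc
    · rw [norm_zero, zero_mul]; exact le_max_of_le_right (norm_nonneg _)
    · have h := norm_smul_le' c⁻¹ (c • f)
      rw [inv_smul_smul₀ hc, norm_inv] at h
      rwa [← le_inv_mul_iff₀ (norm_pos_iff.2 hc)]
  norm_triangle f g := by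
    rw [norm_def, map_add]
    refine max_le ?_ ?_
    · have h := ENNReal.toReal_mono
        (ENNReal.add_ne_top.2 ⟨f.lipNumber_lt_top.ne, g.lipNumber_lt_top.ne⟩)
        (d.lipNumber_add_le (incl d f) (incl d g))
      rw [ENNReal.toReal_add f.lipNumber_lt_top.ne g.lipNumber_lt_top.ne] at h
      exact h.trans (add_le_add (le_max_left _ _) (le_max_left _ _))
    · exact (norm_add_le _ _).trans (add_le_add (le_max_right _ _) (le_max_right _ _))
  norm_eq_zero_iff f := by
    constructor
    · intro h
      have h1 : ‖incl d f‖ ≤ 0 := h ▸ le_max_right _ _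
      exact Subtype.ext (norm_le_zero_iff.1 h1)
    · rintro rfl
      simpa using norm_smul_le' 0 (0 : Lip d) |>.antisymm (le_max_of_le_right (by simp))

instance : NormedAddCommGroup (Lip d) := NormedAddCommGroup.ofCore (normCore d)

instance : NormedSpace ℝ (Lip d) := NormedSpace.ofCore (normCore d)

end Lip

/-! ### Modules over `L^∞` -/

end MeasurablePseudometric

section Modules

variable {X : Type u} [MeasurableSpace X] (μ : Measure X)
  (E : Type u) [NormedAddCommGroup E] [NormedSpace ℝ E] [Module (Linf μ) E]

/-- Banach modules over `L^∞`. -/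
structure IsBanachModule : Prop where
  complete : CompleteSpace E
  isScalarTower : IsScalarTower ℝ (Linf μ) E
  norm_smul_le : ∀ (f : Linf μ) (φ : E), ‖f • φ‖ ≤ ‖f‖ * ‖φ‖

variable {E} in
/-- `N` is an `L^∞`-valued pointwise norm `φ ↦ |φ|` on `E`. -/
structure IsPointwiseNorm (N : E → Linf μ) : Prop where
  nonneg : ∀ φ, 0 ≤ N φ
  norm_eq : ∀ φ, ‖φ‖ = ‖N φ‖
  smul : ∀ (f : Linf μ) (φ : E), N (f • φ) = |f| * N φ

/-- `L^∞`-normed modules. -/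
def IsLinfNormedModule : Prop :=
  IsBanachModule μ E ∧ ∃ N : E → Linf μ, IsPointwiseNorm μ N

variable {E} in
/-- The weak* topology on `E` coming from an identification of `E` with the dual of `F`. -/
@[reducible] def weakStarOf {F : Type u} [NormedAddCommGroup F] [NormedSpace ℝ F]
    (e : E ≃ₗᵢ[ℝ] StrongDual ℝ F) : TopologicalSpace E :=
  TopologicalSpace.induced (fun (φ : E) (v : F) => e φ v) inferInstance

/-- Abelian W*-modules: `L^∞`-normed modules which are dual Banach spaces such that the product
map `L^∞ × E → E` is separately weak*-continuous. -/
def IsAbelianWStarModule : Prop :=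
  IsLinfNormedModule μ E ∧
    ∃ (F : Type u) (_ : NormedAddCommGroup F) (_ : NormedSpace ℝ F) (_ : CompleteSpace F)
      (e : E ≃ₗᵢ[ℝ] StrongDual ℝ F),
      (∀ φ : E, @Continuous _ _ (Linf.weakStar μ) (weakStarOf e) fun f : Linf μ => f • φ) ∧
      (∀ f : Linf μ, @Continuous _ _ (weakStarOf e) (weakStarOf e) fun φ : E => f • φ)

/-- The bounded `L^∞`-module homomorphisms from `E` into `L^∞`. -/
def dualSubmodule : Submodule (Linf μ) (E →L[ℝ] Linf μ) where
  carrier := {Φ | ∀ (f : Linf μ) (φ : E), Φ (f • φ) = f * Φ φ}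
  add_mem' {Φ Ψ} hΦ hΨ f φ := by
    rw [_root_.add_apply, _root_.add_apply, hΦ, hΨ, mul_add]
  zero_mem' f φ := by simp
  smul_mem' g Φ hΦ f φ := by
    rw [_root_.smul_apply, _root_.smul_apply, hΦ, smul_eq_mul,
      smul_eq_mul, mul_left_comm]

/-- The dual module `E'`: the bounded `L^∞`-module homomorphisms from `E` into `L^∞`, with the
operator norm and the action `(f Φ)(φ) = f · Φ(φ)`. -/
def DualModule : Type u := dualSubmodule μ E

instance : NormedAddCommGroup (DualModule μ E) :=
  inferInstanceAs (NormedAddCommGroup (dualSubmodule μ E))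

instance : NormedSpace ℝ (DualModule μ E) :=
  inferInstanceAs (NormedSpace ℝ (dualSubmodule μ E))

instance : Module (Linf μ) (DualModule μ E) :=
  inferInstanceAs (Module (Linf μ) (dualSubmodule μ E))

instance : CoeFun (DualModule μ E) fun _ => E → Linf μ := ⟨fun Φ => Φ.1⟩

/-- `E` is reflexive: the natural map `φ ↦ (Φ ↦ Φ(φ))` from `E` into `E''` is onto. -/
def IsReflexiveModule : Prop :=
  ∀ T : DualModule μ (DualModule μ E), ∃ φ : E, ∀ Φ : DualModule μ E, T Φ = Φ φ

/-- The parallelogram law `|φ + ψ|² + |φ - ψ|² = 2|φ|² + 2|ψ|²` for the pointwise norm of `E`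
(a pointwise norm is unique if it exists). -/
def ParallelogramLaw : Prop :=
  ∀ N : E → Linf μ, IsPointwiseNorm μ N →
    ∀ φ ψ : E, N (φ + ψ) ^ 2 + N (φ - ψ) ^ 2 = 2 * N φ ^ 2 + 2 * N ψ ^ 2

/-- Hilbert module structures over `L^∞` on `E`: `L^∞`-valued inner products which induce the
given complete norm. -/
structure HilbertModuleStructure where
  isBanachModule : IsBanachModule μ E
  /-- the `L^∞`-valued inner product -/
  inner : E → E → Linf μ
  symm : ∀ φ ψ, inner φ ψ = inner ψ φ
  add_left : ∀ φ φ' ψ, inner (φ + φ') ψ = inner φ ψ + inner φ' ψ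
  smul_left : ∀ (f : Linf μ) (φ ψ : E), inner (f • φ) ψ = f * inner φ ψ
  nonneg : ∀ φ, 0 ≤ inner φ φ
  norm_sq : ∀ φ, ‖φ‖ ^ 2 = ‖inner φ φ‖

variable {μ E} in
/-- A Hilbert module is self-dual if every bounded module map `E → L^∞` is `⟨·, ψ⟩` for some
`ψ` in `E`. -/
def HilbertModuleStructure.IsSelfDual (H : HilbertModuleStructure μ E) : Prop :=
  ∀ Φ : DualModule μ E, ∃ ψ : E, ∀ φ : E, Φ φ = H.inner φ ψ

end Modules

/-! ### Measurable vector fields and measurable 1-forms -/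

namespace MeasurablePseudometric

variable {X : Type u} [MeasurableSpace X] {μ : Measure X}

/-- The canonical predual of `Lip(M)`: the bounded linear functionals whose restriction to the
closed unit ball of `Lip(M)` is continuous for the weak* topology of `L^∞`. -/
def lipPredual (d : MeasurablePseudometric μ) : Set (StrongDual ℝ (Lip d)) :=
  {ℓ | @ContinuousOn _ _ (TopologicalSpace.induced (Lip.incl d) (Linf.weakStar μ)) _ ℓ
    (Metric.closedBall (0 : Lip d) 1)}

/-- The weak* topology of the dual Banach space `Lip(M)`. -/
@[reducible] def lipWeakStar (d : MeasurablePseudometric μ) : TopologicalSpace (Lip d) :=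
  TopologicalSpace.induced (fun (f : Lip d) (ℓ : d.lipPredual) => ℓ.1 f) inferInstance

/-- The metric derivations from `Lip(M)` into `L^∞`, i.e. the bounded weak*-continuous linear
maps which satisfy the Leibniz rule. -/
def metricDerivations (d : MeasurablePseudometric μ) : Submodule (Linf μ) (Lip d →L[ℝ] Linf μ) where
  carrier := {δ | @Continuous _ _ d.lipWeakStar (Linf.weakStar μ) δ ∧
    ∀ f g : Lip d, δ (f * g) = Lip.incl d f * δ g + Lip.incl d g * δ f}
  add_mem' {δ ε} hδ hε := by
    refine ⟨?_, fun f g => ?_⟩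
    · let := d.lipWeakStar
      refine Linf.continuous_weakStar_iff.2 fun g => ?_
      refine ((Linf.continuous_weakStar_iff.1 hδ.1 g).add
        (Linf.continuous_weakStar_iff.1 hε.1 g)).congr fun f => ?_
      rw [Pi.add_apply]
      rw [← integral_add (Linf.integrable_mul _ _) (Linf.integrable_mul _ _)]
      refine integral_congr_ae ?_
      filter_upwards [Lp.coeFn_add (δ f) (ε f)] with x hx
      rw [_root_.add_apply, hx, Pi.add_apply, add_mul]
    · simp only [_root_.add_apply, hδ.2, hε.2]
      ring
  zero_mem' := by
    refine ⟨?_, fun f g => by simp⟩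
    let := d.lipWeakStar
    let := Linf.weakStar μ
    exact continuous_const (y := (0 : Linf μ))
  smul_mem' h δ hδ := by
    refine ⟨?_, fun f g => ?_⟩
    · let := d.lipWeakStar
      refine Linf.continuous_weakStar_iff.2 fun g => ?_
      refine (Linf.continuous_weakStar_iff.1 hδ.1 (h • g : Lp ℝ 1 μ)).congr fun f => ?_
      refine integral_congr_ae ?_
      filter_upwards [Linf.coeFn_mul h (δ f), Lp.coeFn_lpSMul (r := 1) h g] with x hx hx'
      rw [_root_.smul_apply, smul_eq_mul, hx, hx', Pi.smul_apply', smul_eq_mul]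
      ring
    · simp only [_root_.smul_apply, hδ.2, smul_eq_mul]
      ring

/-- The module `𝒳(M)` of measurable vector fields: the metric derivations from `Lip(M)` into
`L^∞`, with the operator norm and the action `(f δ)(g) = f · δ(g)`. -/
def VectorFields (d : MeasurablePseudometric μ) : Type u := d.metricDerivations

instance (d : MeasurablePseudometric μ) : NormedAddCommGroup d.VectorFields :=
  inferInstanceAs (NormedAddCommGroup d.metricDerivations)

instance (d : MeasurablePseudometric μ) : NormedSpace ℝ d.VectorFields :=
  inferInstanceAs (NormedSpace ℝ d.metricDerivations)

instance (d : MeasurablePseudometric μ) : Module (Linf μ) d.VectorFields :=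
  inferInstanceAs (Module (Linf μ) d.metricDerivations)

instance (d : MeasurablePseudometric μ) : CoeFun d.VectorFields fun _ => Lip d → Linf μ :=
  ⟨fun δ => δ.1⟩

/-- The module `Ω(M) = 𝒳(M)'` of measurable 1-forms. -/
abbrev OneForms (d : MeasurablePseudometric μ) : Type u := DualModule μ d.VectorFields

/-- The topology of pointwise weak* convergence on `𝒳(M)`: `δ_i → δ` if and only if
`δ_i(f) → δ(f)` weak* in `L^∞` for all `f` in `Lip(M)`. -/
@[reducible] def pointwiseWeakStar (d : MeasurablePseudometric μ) :
    TopologicalSpace d.VectorFields :=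
  TopologicalSpace.induced
    (fun (δ : d.VectorFields) (p : Lip d × Lp ℝ 1 μ) => ∫ x, δ p.1 x * p.2 x ∂μ) inferInstance

/-- `𝒳(M)` is finitely generated: finitely many elements have an `L^∞`-linear span which is
dense for pointwise weak* convergence. This is the weakest of the usual meanings; it holds in
particular if `𝒳(M)` is finitely generated algebraically. -/
def VectorFieldsFinitelyGenerated (d : MeasurablePseudometric μ) : Prop :=
  ∃ S : Finset d.VectorFields, @Dense _ d.pointwiseWeakStar
    (Submodule.span (Linf μ) (S : Set d.VectorFields) : Set d.VectorFields)

theorem vectorFieldsFinitelyGenerated_of_finite (d : MeasurablePseudometric μ)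
    (h : Module.Finite (Linf μ) d.VectorFields) : d.VectorFieldsFinitelyGenerated := by
  obtain ⟨S, hS⟩ := h.fg_top
  refine ⟨S, ?_⟩
  rw [hS]
  let := d.pointwiseWeakStar
  exact dense_univ

end MeasurablePseudometric

end

/-!
Reflexivity of `Ω(M) = 𝒳(M)'` replaces all arguments about weak* topologies by one about module
maps. Bounded operators into `L^∞ = (L^1)*` have limits along ultrafilters for pointwise weak*
convergence, and such limits of module maps are module maps
(`DualModule.exists_ultrafilter_limit`).

*Reflexive forms give a W*-module.* A bounded module map `T : Ω(M) → L^∞` restricts to the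
derivation `f ↦ T(df)`, and the point is that this is weak* continuous: if `f' → f` weak* in the
unit ball of `Lip(M)`, then the functionals `T ↦ T(df')` converge along ultrafilters to an element
of `Ω(M)''`, which is evaluation at a form `ω` by reflexivity; weak* continuity of vector fields
gives `ω(δ) = δ(f)` for all `δ`, so `ω = df` (`VectorFields.comp_differential_mem`). Hence `𝒳(M)`
is the dual of the closed span of the functionals `δ ↦ ∫ δ(f) g`: a functional on this space
extends to `𝒳(M)'` by the Hahn–Banach theorem, the extension induces a map `T` as above, and `T`
induces a vector field (`VectorFields.toDualPredual_surjective`).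

*Reflexivity of a dual module.* `E'` is reflexive as soon as each element of `E''` is locally
evaluation at an element of `E` (`DualModule.isReflexiveModule`), where "locally" is expressed by
multiplication with elements of `L^∞`.

*Finitely generated modules.* If `n` vector fields generate `𝒳(M)`, then the determinants
`det (ω_j(δ_i))` of size `n + 1`, for forms `ω_j` in the span of the differentials, vanish, since
this passes to weak* limits in each row. So biorthogonal systems have at most `n` elements, and
over a small set a maximal one is a basis; thus `𝒳(M)` is locally free of finite rank and its
bidual is locally given by evaluations (`DualModule.isReflexiveModule_of_bounded_rank`).

*The parallelogram law.* Polarization gives an `L^∞`-valued inner product. A bounded module map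
`Φ` is bounded for the integrated inner product `∫ ⟨φ, ψ⟩`, so it is represented by a sequence of
vectors which converges in quadratic mean, hence almost uniformly; as `𝒳(M)` is complete, `Φ` is
locally of the form `⟨·, χ⟩` (`HilbertModuleStructure.exists_local_representation`). This gives
reflexivity of the dual, and then the local representatives `χ` have a limit in `𝒳(M)`, which
represents `Φ` globally.
-/

noncomputable section

namespace Linf

variable {X : Type u} [MeasurableSpace X] {μ : Measure X}

/-! ### Order, norm and idempotents in `L^∞` -/

theorem ae_abs_le_norm (f : Linf μ) : ∀ᵐ x ∂μ, |f x| ≤ ‖f‖ := by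
  have h1 := ae_le_eLpNormEssSup (f := f) (μ := μ)
  filter_upwards [h1] with x hx
  have h2 : ‖f x‖ₑ ≤ ‖f‖ₑ := by
    rw [Lp.enorm_def, eLpNorm_exponent_top]; exact hx
  rw [← Real.norm_eq_abs]
  exact enorm_le_iff_norm_le.1 h2

theorem norm_le_of_ae {f : Linf μ} {C : ℝ} (hC : 0 ≤ C) (h : ∀ᵐ x ∂μ, |f x| ≤ C) : ‖f‖ ≤ C := by
  rw [Lp.norm_def, eLpNorm_exponent_top]
  refine ENNReal.toReal_le_of_le_ofReal hC (eLpNormEssSup_le_of_ae_bound ?_)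
  simpa using h

theorem memLp_of_ae_bound {f : X → ℝ} (hf : AEStronglyMeasurable f μ) (C : ℝ)
    (h : ∀ᵐ x ∂μ, |f x| ≤ C) : MemLp f ∞ μ :=
  memLp_top_of_bound hf C (by simpa using h)

theorem aestronglyMeasurable (f : Linf μ) : AEStronglyMeasurable f μ :=
  (Lp.stronglyMeasurable f).aestronglyMeasurable

theorem le_iff {f g : Linf μ} : f ≤ g ↔ ∀ᵐ x ∂μ, f x ≤ g x := (Lp.coeFn_le f g).symm

theorem nonneg_iff {f : Linf μ} : 0 ≤ f ↔ ∀ᵐ x ∂μ, 0 ≤ f x := (Lp.coeFn_nonneg f).symm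

theorem ext_iff {f g : Linf μ} : f = g ↔ ∀ᵐ x ∂μ, f x = g x := Lp.ext_iff

theorem eq_zero_iff {f : Linf μ} : f = 0 ↔ ∀ᵐ x ∂μ, f x = 0 := by
  rw [ext_iff]
  refine Filter.eventually_congr ?_
  filter_upwards [Lp.coeFn_zero ℝ ∞ μ] with x hx
  rw [hx, Pi.zero_apply]

theorem abs_mul (f g : Linf μ) : |f * g| = |f| * |g| := by
  rw [ext_iff]
  filter_upwards [Lp.coeFn_abs (f * g), Lp.coeFn_abs f, Lp.coeFn_abs g, coeFn_mul f g,
    coeFn_mul |f| |g|] with x h1 h2 h3 h4 h5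
  rw [h1, h4, h5, h2, h3, _root_.abs_mul]

theorem norm_mul_self (f : Linf μ) : ‖f * f‖ = ‖f‖ ^ 2 := by
  refine le_antisymm ((norm_mul_le f f).trans_eq (sq _).symm) ?_
  have h : ‖f‖ ≤ √‖f * f‖ := by
    refine norm_le_of_ae (Real.sqrt_nonneg _) ?_
    filter_upwards [ae_abs_le_norm (f * f), coeFn_mul f f] with x h1 h2
    rw [h2, abs_mul_self] at h1
    exact Real.abs_le_sqrt (by rwa [sq])
  calc ‖f‖ ^ 2 ≤ √‖f * f‖ ^ 2 := by gcongr
    _ = ‖f * f‖ := Real.sq_sqrt (norm_nonneg _)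

theorem norm_le_norm_of_abs_le {f g : Linf μ} (h : ∀ᵐ x ∂μ, |f x| ≤ |g x|) : ‖f‖ ≤ ‖g‖ := by
  refine norm_le_of_ae (norm_nonneg g) ?_
  filter_upwards [h, ae_abs_le_norm g] with x h1 h2 using h1.trans h2

/-- A bounded measurable function as an element of `L^∞`, with its almost everywhere values. -/
theorem exists_coeFn_eq {f : X → ℝ} (hf : AEStronglyMeasurable f μ) (C : ℝ)
    (h : ∀ᵐ x ∂μ, |f x| ≤ C) : ∃ F : Linf μ, ∀ᵐ x ∂μ, F x = f x :=
  ⟨(memLp_of_ae_bound hf C h).toLp f, MemLp.coeFn_toLp _⟩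

/-- The characteristic function of a measurable set. -/
theorem exists_indicator {A : Set X} (hA : MeasurableSet A) :
    ∃ q : Linf μ, (∀ᵐ x ∂μ, q x = A.indicator (fun _ => 1) x) ∧ q * q = q := by
  obtain ⟨q, hq⟩ := exists_coeFn_eq (μ := μ) (f := A.indicator (fun _ => (1 : ℝ)))
    ((stronglyMeasurable_const.indicator hA).aestronglyMeasurable) 1
    (Filter.Eventually.of_forall fun x => by by_cases hx : x ∈ A <;> simp [hx])
  refine ⟨q, hq, ?_⟩
  rw [ext_iff]
  filter_upwards [hq, coeFn_mul q q] with x h1 h2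
  by_cases hx : x ∈ A <;> simp [h2, h1, hx]

/-- A nonzero element of `L^∞` is invertible on a set of positive measure. -/
theorem exists_mul_eq_idempotent {m : Linf μ} (hm : m ≠ 0) :
    ∃ c q : Linf μ, q * q = q ∧ q ≠ 0 ∧ c * m = q := by
  have hmm : Measurable m := (Lp.stronglyMeasurable m).measurable
  obtain ⟨n, hn⟩ : ∃ n : ℕ, μ {x | 1 / ((n : ℝ) + 1) < |m x|} ≠ 0 := by
    by_contra! h
    apply hm
    rw [eq_zero_iff]
    have h' : ∀ᵐ x ∂μ, ∀ n : ℕ, |m x| ≤ 1 / ((n : ℝ) + 1) := by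
      rw [ae_all_iff]
      intro n
      rw [ae_iff]
      simpa using h n
    filter_upwards [h'] with x hx
    have := ge_of_tendsto' (tendsto_one_div_add_atTop_nhds_zero_nat (𝕜 := ℝ)) hx
    exact abs_eq_zero.1 (le_antisymm this (abs_nonneg _))
  set A := {x | 1 / ((n : ℝ) + 1) < |m x|} with hA
  have hAm : MeasurableSet A := measurableSet_lt measurable_const hmm.abs
  have hpos : (0 : ℝ) < 1 / ((n : ℝ) + 1) := Nat.one_div_pos_of_nat
  obtain ⟨q, hq, hqq⟩ := exists_indicator (μ := μ) hAm
  obtain ⟨c, hc⟩ := exists_coeFn_eq (μ := μ) (f := A.indicator fun x => (m x)⁻¹)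
    (hmm.inv.stronglyMeasurable.indicator hAm).aestronglyMeasurable ((n : ℝ) + 1)
    (Filter.Eventually.of_forall fun x => by
      by_cases hx : x ∈ A
      · rw [indicator_of_mem hx, abs_inv]
        have : 1 / ((n : ℝ) + 1) < |m x| := hx
        rw [one_div] at this
        exact inv_le_of_inv_le₀ (by positivity) this.le
      · rw [indicator_of_notMem hx]; simp; positivity)
  refine ⟨c, q, hqq, ?_, ?_⟩
  · intro h0
    apply hn
    rw [measure_eq_zero_iff_ae_notMem]
    rw [eq_zero_iff] at h0
    filter_upwards [h0, hq] with x h1 h2 hx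
    rw [h1, indicator_of_mem hx] at h2
    exact zero_ne_one h2
  · rw [ext_iff]
    filter_upwards [hc, hq, coeFn_mul c m] with x h1 h2 h3
    by_cases hx : x ∈ A
    · have : m x ≠ 0 := abs_pos.1 (hpos.trans hx)
      simp [h3, h1, h2, hx, this]
    · simp [h3, h1, h2, hx]

/-! ### Suprema in `L^∞` -/

/-- `L^∞` over a `σ`-finite measure space is Dedekind complete. The supremum is the pointwise
supremum of a sequence of finite suprema whose integrals against an equivalent finite measure
are maximal. -/
theorem exists_isLUB [SFinite μ] {S : Set (Linf μ)} (hne : S.Nonempty) {b : Linf μ}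
    (hb : b ∈ upperBounds S) : ∃ u, IsLUB S u := by
  set ν := μ.toFinite
  have hae : ae ν = ae μ := ae_toFinite
  have hint : ∀ f : Linf μ, Integrable f ν := fun f =>
    Integrable.of_bound (C := ‖f‖)
      ((aestronglyMeasurable f).mono_ac (toFinite_absolutelyContinuous μ))
      (by rw [hae]; simpa using ae_abs_le_norm f)
  -- the suprema of finite subfamilies
  let G : Set (Linf μ) := {u | ∃ (s : Finset (Linf μ)) (hs : s.Nonempty), ↑s ⊆ S ∧ u = s.sup' hs id}
  have hGle : ∀ u ∈ G, u ≤ b := by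
    rintro u ⟨s, hs, hsS, rfl⟩
    exact Finset.sup'_le _ _ fun v hv => hb (hsS hv)
  have hSG : S ⊆ G := fun v hv => ⟨{v}, Finset.singleton_nonempty v, by simpa using hv, by simp⟩
  have hGsup : ∀ u ∈ G, ∀ v ∈ G, u ⊔ v ∈ G := by
    classical
    rintro u ⟨s, hs, hsS, rfl⟩ v ⟨t, ht, htS, rfl⟩
    exact ⟨s ∪ t, hs.mono Finset.subset_union_left, by simp [hsS, htS],
      (Finset.sup'_union hs ht id).symm⟩
  have hmono : ∀ u v : Linf μ, u ≤ v → ∫ x, u x ∂ν ≤ ∫ x, v x ∂ν := fun u v h =>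
    integral_mono_ae (hint u) (hint v) (by
      change ∀ᵐ x ∂ν, u x ≤ v x
      rw [hae]; exact le_iff.1 h)
  let I : Set ℝ := (fun u : Linf μ => ∫ x, u x ∂ν) '' G
  have hIne : I.Nonempty := (hne.mono hSG).image _
  have hIb : BddAbove I := ⟨∫ x, b x ∂ν, by
    rintro _ ⟨u, hu, rfl⟩; exact hmono u b (hGle u hu)⟩
  obtain ⟨a, -, hat, haI⟩ := exists_seq_tendsto_sSup hIne hIb
  choose w hwG hw using haI
  let W : ℕ → Linf μ := fun n => partialSups w n
  have hWG : ∀ n, W n ∈ G := by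
    intro n
    induction n with
    | zero => simpa [W] using hwG 0
    | succ n ih => simpa [W, partialSups_add_one] using hGsup _ ih _ (hwG (n + 1))
  have hWmono : Monotone W := (partialSups w).monotone
  have hWt : Filter.Tendsto (fun n => ∫ x, W n x ∂ν) Filter.atTop (𝓝 (sSup I)) := by
    refine tendsto_of_tendsto_of_tendsto_of_le_of_le hat tendsto_const_nhds (fun n => ?_)
      (fun n => le_csSup hIb ⟨_, hWG n, rfl⟩)
    rw [← hw n]
    exact hmono _ _ (le_partialSups w n)
  have hWm : ∀ᵐ x ∂μ, Monotone fun n => W n x := by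
    have : ∀ᵐ x ∂μ, ∀ n, W n x ≤ W (n + 1) x :=
      ae_all_iff.2 fun n => le_iff.1 (hWmono n.le_succ)
    filter_upwards [this] with x hx using monotone_nat_of_le_succ hx
  have hWb : ∀ᵐ x ∂μ, ∀ n, W n x ≤ b x := ae_all_iff.2 fun n => le_iff.1 (hGle _ (hWG n))
  have hbd : ∀ᵐ x ∂μ, |⨆ n, W n x| ≤ max ‖b‖ ‖W 0‖ := by
    filter_upwards [hWb, ae_abs_le_norm b, ae_abs_le_norm (W 0)] with x h1 h2 h3
    rw [abs_le]
    constructor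
    · calc -max ‖b‖ ‖W 0‖ ≤ -‖W 0‖ := neg_le_neg (le_max_right _ _)
        _ ≤ W 0 x := (abs_le.1 h3).1
        _ ≤ _ := le_ciSup (f := fun n => W n x) ⟨b x, by rintro _ ⟨n, rfl⟩; exact h1 n⟩ 0
    · exact (ciSup_le h1).trans (((abs_le.1 h2).2).trans (le_max_left _ _))
  obtain ⟨u, hu⟩ := exists_coeFn_eq (μ := μ) (f := fun x => ⨆ n, W n x)
    (Measurable.iSup fun n => (Lp.stronglyMeasurable (W n)).measurable).aestronglyMeasurable _ hbd
  have hWu : ∀ n, W n ≤ u := fun n => by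
    rw [le_iff]
    filter_upwards [hu, hWb] with x h1 h2
    rw [h1]
    exact le_ciSup (f := fun n => W n x) ⟨b x, by rintro _ ⟨n, rfl⟩; exact h2 n⟩ n
  have huI : ∫ x, u x ∂ν = sSup I := by
    refine tendsto_nhds_unique (integral_tendsto_of_tendsto_of_monotone (fun n => hint (W n))
      (hint u) (by rw [hae]; exact hWm) ?_) hWt
    rw [hae]
    filter_upwards [hWm, hu, hWb] with x h1 h2 h3
    rw [h2]
    exact tendsto_atTop_ciSup h1 ⟨b x, by rintro _ ⟨n, rfl⟩; exact h3 n⟩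
  refine ⟨u, fun v hv => ?_, fun v hv => ?_⟩
  · -- `u ⊔ v` has the same integral as `u`
    have hle : ∫ x, (u ⊔ v : Linf μ) x ∂ν ≤ sSup I := by
      refine le_of_tendsto' (x := Filter.atTop)
        (f := fun n => ∫ x, (W n ⊔ v : Linf μ) x ∂ν)
        (integral_tendsto_of_tendsto_of_monotone (fun n => hint _) (hint _) ?_ ?_)
        (fun n => le_csSup hIb ⟨_, hGsup _ (hWG n) _ (hSG hv), rfl⟩)
      · rw [hae]
        have h0 : ∀ᵐ x ∂μ, ∀ n, (W n ⊔ v : Linf μ) x = W n x ⊔ v x :=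
          ae_all_iff.2 fun n => Lp.coeFn_sup _ _
        filter_upwards [hWm, h0] with x h1 h2 n k hnk
        simp only [h2]
        exact sup_le_sup_right (h1 hnk) _
      · rw [hae]
        have h0 : ∀ᵐ x ∂μ, ∀ n, (W n ⊔ v : Linf μ) x = W n x ⊔ v x :=
          ae_all_iff.2 fun n => Lp.coeFn_sup _ _
        filter_upwards [hWm, h0, hu, hWb, Lp.coeFn_sup u v] with x h1 h2 h3 h4 h5
        simp only [h2]
        rw [h5, Pi.sup_apply, h3]
        exact (tendsto_atTop_ciSup h1 ⟨b x, by rintro _ ⟨n, rfl⟩; exact h4 n⟩).sup_nhds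
          tendsto_const_nhds
    have hle' : ∀ᵐ x ∂ν, u x ≤ (u ⊔ v : Linf μ) x := by rw [hae]; exact le_iff.1 le_sup_left
    have heq := (integral_eq_iff_of_ae_le (hint u) (hint _) hle').1
      (le_antisymm (hmono _ _ le_sup_left) (hle.trans_eq huI.symm))
    have : u = u ⊔ v := Lp.ext (by rw [← hae]; exact heq)
    rw [this]
    exact le_sup_right
  · have hGv : ∀ w ∈ G, w ≤ v := by
      rintro w ⟨s, hs, hsS, rfl⟩
      exact Finset.sup'_le _ _ fun z hz => hv (hsS hz)
    rw [le_iff]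
    have h0 : ∀ᵐ x ∂μ, ∀ n, W n x ≤ v x := ae_all_iff.2 fun n => le_iff.1 (hGv _ (hWG n))
    filter_upwards [hu, h0] with x h1 h2
    rw [h1]
    exact ciSup_le h2

end Linf

namespace Linf

variable {X : Type u} [MeasurableSpace X] {μ : Measure X}

/-! ### `L^∞` as the dual of `L^1` -/

/-- The pairing `(f, g) ↦ ∫ f g` of `L^∞` with `L^1`. -/
def pairing (μ : Measure X) : Linf μ →L[ℝ] Lp ℝ 1 μ →L[ℝ] ℝ :=
  (ContinuousLinearMap.mul ℝ ℝ).lpPairing μ ∞ 1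

theorem pairing_apply (f : Linf μ) (g : Lp ℝ 1 μ) : pairing μ f g = ∫ x, f x * g x ∂μ :=
  (ContinuousLinearMap.mul ℝ ℝ).lpPairing_eq_integral f g

theorem abs_pairing_le (f : Linf μ) (g : Lp ℝ 1 μ) : |pairing μ f g| ≤ ‖f‖ * ‖g‖ := by
  rw [pairing_apply, L1.norm_eq_integral_norm, ← integral_const_mul]
  refine (abs_integral_le_integral_abs).trans (integral_mono_ae (integrable_mul f g).abs
    ((L1.integrable_coeFn g).norm.const_mul _) ?_)
  filter_upwards [ae_abs_le_norm f] with x hx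
  simp only [_root_.abs_mul, Real.norm_eq_abs]
  gcongr

theorem pairing_mul (f h : Linf μ) (g : Lp ℝ 1 μ) :
    pairing μ (f * h) g = pairing μ h (f • g : Lp ℝ 1 μ) := by
  rw [pairing_apply, pairing_apply]
  refine integral_congr_ae ?_
  filter_upwards [coeFn_mul f h, Lp.coeFn_lpSMul (r := 1) f g] with x h1 h2
  rw [h1, h2, Pi.smul_apply', smul_eq_mul]
  ring

theorem pairing_mul' (f h : Linf μ) (g : Lp ℝ 1 μ) :
    pairing μ (f * h) g = pairing μ f (h • g : Lp ℝ 1 μ) := by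
  rw [mul_comm, pairing_mul]

/-- A strictly positive square integrable function, which is used to pass from `L^1` to `L^2`. -/
theorem exists_pos_memLp_two (μ : Measure X) [SigmaFinite μ] :
    ∃ v : X → ℝ, (∀ x, 0 < v x) ∧ Measurable v ∧ MemLp v 2 μ := by
  obtain ⟨w, hw0, hwm, hwi⟩ := exists_pos_lintegral_lt_of_sigmaFinite μ (ε := 1) one_ne_zero
  have hm : Measurable fun x => √(w x : ℝ) := hwm.coe_nnreal_real.sqrt
  refine ⟨fun x => √(w x), fun x => Real.sqrt_pos.2 (by exact_mod_cast hw0 x), hm, ?_⟩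
  rw [memLp_two_iff_integrable_sq hm.aestronglyMeasurable]
  simp only [Real.sq_sqrt (NNReal.coe_nonneg _)]
  refine ⟨hwm.coe_nnreal_real.aestronglyMeasurable, ?_⟩
  rw [hasFiniteIntegral_iff_enorm]
  refine lt_of_eq_of_lt ?_ (hwi.trans ENNReal.one_lt_top)
  simp

theorem pairing_injective [SigmaFinite μ] {f : Linf μ} (h : pairing μ f = 0) : f = 0 := by
  obtain ⟨v, hv0, hvm, hv⟩ := exists_pos_memLp_two μ
  have hv2 : Integrable (fun x => v x ^ 2) μ := hv.integrable_sq
  have hi : Integrable (fun x => f x * v x ^ 2) μ :=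
    hv2.bdd_mul (aestronglyMeasurable f) (c := ‖f‖) (by simpa using ae_abs_le_norm f)
  have h1 : pairing μ f hi.toL1 = 0 := by rw [h]; rfl
  rw [pairing_apply] at h1
  have h2 : ∫ x, f x * (f x * v x ^ 2) ∂μ = 0 := by
    rw [← h1]
    refine integral_congr_ae ?_
    filter_upwards [hi.coeFn_toL1] with x hx
    rw [hx]
  have hi2 : Integrable (fun x => f x * (f x * v x ^ 2)) μ :=
    hi.bdd_mul (aestronglyMeasurable f) (c := ‖f‖) (by simpa using ae_abs_le_norm f)
  rw [integral_eq_zero_iff_of_nonneg (fun x => by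
    change 0 ≤ f x * (f x * v x ^ 2)
    rw [← mul_assoc]; exact mul_nonneg (mul_self_nonneg _) (sq_nonneg _)) hi2] at h2
  rw [eq_zero_iff]
  filter_upwards [h2] with x hx
  have := (hv0 x).ne'
  simpa [this] using hx

theorem pairing_ext [SigmaFinite μ] {f f' : Linf μ}
    (h : ∀ g : Lp ℝ 1 μ, pairing μ f g = pairing μ f' g) : f = f' :=
  sub_eq_zero.1 <| pairing_injective <| by ext g; simp [h g]

/-- Every bounded functional on `L^1` is given by an element of `L^∞`. It is composed with the
multiplication `L^2 → L^1` by a positive function of `L^2`, to which the Riesz representation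
theorem applies. -/
theorem exists_pairing_eq [SigmaFinite μ] (L : StrongDual ℝ (Lp ℝ 1 μ)) :
    ∃ f : Linf μ, pairing μ f = L ∧ ‖f‖ ≤ ‖L‖ := by
  obtain ⟨v, hv0, hvm, hv⟩ := exists_pos_memLp_two μ
  let V : Lp ℝ 2 μ := hv.toLp v
  let M : Lp ℝ 2 μ →L[ℝ] Lp ℝ 1 μ := (ContinuousLinearMap.mul ℝ ℝ).holderL μ 2 2 1 V
  have hM : ∀ u : Lp ℝ 2 μ, ∀ᵐ x ∂μ, M u x = v x * u x := fun u => by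
    filter_upwards [(ContinuousLinearMap.mul ℝ ℝ).coeFn_holder (r := 1) V u,
      hv.coeFn_toLp] with x h1 h2
    change ((ContinuousLinearMap.mul ℝ ℝ).holder 1 V u) x = _
    rw [h1, h2]; rfl
  let h : Lp ℝ 2 μ := (InnerProductSpace.toDual ℝ (Lp ℝ 2 μ)).symm (L ∘L M)
  have hh : ∀ u : Lp ℝ 2 μ, ∫ x, h x * u x ∂μ = L (M u) := fun u => by
    have h1 : inner ℝ h u = (L ∘L M) u := by simp [h]
    rw [L2.inner_def] at h1
    rw [ContinuousLinearMap.comp_apply] at h1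
    rw [← h1]
    exact integral_congr_ae (Filter.Eventually.of_forall fun x => by simp [mul_comm])
  have hhm : Measurable h := (Lp.stronglyMeasurable h).measurable
  -- a test function supported where the desired bound fails
  let A : Set X := {x | ‖L‖ * v x < |h x|}
  have hA : MeasurableSet A := measurableSet_lt (hvm.const_mul _) hhm.abs
  have hbound : ∀ᵐ x ∂μ, |h x| ≤ ‖L‖ * v x := by
    have hsm' : Measurable fun x => h x / |h x| := hhm.div hhm.abs
    have hs : ∀ x, |h x / (|h x|)| ≤ 1 := fun x => by
      rw [abs_div, abs_abs]; exact div_self_le_one |h x|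
    have hu : MemLp (A.indicator fun x => h x / |h x| * v x) 2 μ := by
      refine hv.mono ((hsm'.mul hvm).indicator hA).aestronglyMeasurable
        (Filter.Eventually.of_forall fun x => ?_)
      by_cases hx : x ∈ A
      · rw [indicator_of_mem hx, norm_mul, Real.norm_eq_abs]
        exact mul_le_of_le_one_left (norm_nonneg _) (hs x)
      · rw [indicator_of_notMem hx, norm_zero]; exact norm_nonneg _
    let u : Lp ℝ 2 μ := hu.toLp _
    have h1 : ∫ x, h x * u x ∂μ = ∫ x, A.indicator (fun x => |h x| * v x) x ∂μ := by
      refine integral_congr_ae ?_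
      filter_upwards [hu.coeFn_toLp] with x hx
      rw [hx]
      by_cases hxA : x ∈ A
      · simp only [indicator_of_mem hxA]
        rw [← mul_assoc, mul_div_assoc', ← abs_mul_abs_self, mul_self_div_self]
      · simp [hxA]
    have h2 : ‖M u‖ ≤ ∫ x, A.indicator (fun x => v x * v x) x ∂μ := by
      rw [L1.norm_eq_integral_norm]
      refine integral_mono_ae (L1.integrable_coeFn _).norm
        ((hv.integrable_mul hv).indicator hA) ?_
      filter_upwards [hM u, hu.coeFn_toLp] with x h1 h2
      rw [h1, h2]
      by_cases hxA : x ∈ A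
      · simp only [indicator_of_mem hxA, norm_mul, Real.norm_eq_abs]
        rw [abs_of_pos (hv0 x)]
        have := hv0 x
        have := hs x
        gcongr
        exact mul_le_of_le_one_left (hv0 x).le (hs x)
      · simp [hxA]
    have h3 : ∫ x, A.indicator (fun x => |h x| * v x) x ∂μ
        ≤ ‖L‖ * ∫ x, A.indicator (fun x => v x * v x) x ∂μ := by
      rw [← h1, hh u]
      exact (le_abs_self _).trans ((L.le_opNorm _).trans (by gcongr))
    have hi1 : Integrable (A.indicator fun x => |h x| * v x) μ :=
      (((Lp.memLp h).abs.integrable_mul hv)).indicator hA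
    have hi2 : Integrable (A.indicator fun x => v x * v x) μ :=
      (hv.integrable_mul hv).indicator hA
    have h4 : ∫ x, (A.indicator (fun x => |h x| * v x) x
        - ‖L‖ * A.indicator (fun x => v x * v x) x) ∂μ ≤ 0 := by
      rw [integral_sub hi1 (hi2.const_mul _), integral_const_mul]
      linarith
    have h5 : ∀ x, 0 ≤ A.indicator (fun x => |h x| * v x) x
        - ‖L‖ * A.indicator (fun x => v x * v x) x := fun x => by
      by_cases hxA : x ∈ A
      · simp only [indicator_of_mem hxA]
        have h6 : ‖L‖ * v x < |h x| := hxA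
        have := hv0 x
        nlinarith
      · simp [hxA]
    have h7 := (integral_eq_zero_iff_of_nonneg h5 (hi1.sub (hi2.const_mul _))).1
      (le_antisymm h4 (integral_nonneg h5))
    filter_upwards [h7] with x hx
    by_contra hxA
    have hxA' : x ∈ A := not_le.1 hxA
    have h6 : ‖L‖ * v x < |h x| := hxA'
    simp only [indicator_of_mem hxA', Pi.zero_apply] at hx
    have := hv0 x
    nlinarith
  have hfb : ∀ᵐ x ∂μ, |h x / v x| ≤ ‖L‖ := by
    filter_upwards [hbound] with x hx
    rwa [abs_div, abs_of_pos (hv0 x), div_le_iff₀ (hv0 x)]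
  obtain ⟨f, hf⟩ := exists_coeFn_eq (μ := μ) (f := fun x => h x / v x)
    (hhm.div hvm).aestronglyMeasurable _ hfb
  refine ⟨f, ?_, norm_le_of_ae (norm_nonneg _) (by
    filter_upwards [hf, hfb] with x h1 h2
    rwa [h1])⟩
  have hvu : ∀ u : Lp ℝ 2 μ, pairing μ f (M u) = L (M u) := fun u => by
    rw [← hh u, pairing_apply]
    refine integral_congr_ae ?_
    filter_upwards [hM u, hf] with x h1 h2
    rw [h1, h2]
    have := (hv0 x).ne'
    field_simp
  ext g
  have hgm : Measurable g := (Lp.stronglyMeasurable g).measurable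
  -- truncations of `g` lie in the range of `M` and converge to `g`
  let B : ℕ → Set X := fun n => {x | |g x| ≤ n * v x ^ 2}
  have hB : ∀ n, MeasurableSet (B n) := fun n =>
    measurableSet_le hgm.abs ((hvm.pow_const 2).const_mul _)
  have hu : ∀ n, MemLp ((B n).indicator fun x => g x / v x) 2 μ := fun n => by
    refine (hv.const_mul (n : ℝ)).mono ((hgm.div hvm).indicator (hB n)).aestronglyMeasurable
      (Filter.Eventually.of_forall fun x => ?_)
    by_cases hx : x ∈ B n
    · have hx' : |g x| ≤ n * v x ^ 2 := hx
      rw [indicator_of_mem hx, Real.norm_eq_abs, Real.norm_eq_abs, abs_div, abs_of_pos (hv0 x),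
        abs_of_nonneg (mul_nonneg n.cast_nonneg (hv0 x).le), div_le_iff₀ (hv0 x)]
      linarith
    · rw [indicator_of_notMem hx, norm_zero]; exact norm_nonneg _
  let G : ℕ → Lp ℝ 1 μ := fun n => M ((hu n).toLp _)
  have hG : ∀ n, ∀ᵐ x ∂μ, G n x = (B n).indicator g x := fun n => by
    filter_upwards [hM ((hu n).toLp _), (hu n).coeFn_toLp] with x h1 h2
    rw [h1, h2]
    by_cases hx : x ∈ B n
    · simp only [indicator_of_mem hx]
      have := (hv0 x).ne'
      field_simp
    · simp [hx]
  have hGt : Filter.Tendsto G Filter.atTop (𝓝 g) := by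
    rw [tendsto_iff_norm_sub_tendsto_zero]
    have h1 : ∀ n, ‖G n - g‖ = ∫ x, ‖(B n).indicator g x - g x‖ ∂μ := fun n => by
      rw [L1.norm_eq_integral_norm]
      refine integral_congr_ae ?_
      filter_upwards [Lp.coeFn_sub (G n) g, hG n] with x h1 h2
      rw [h1, Pi.sub_apply, h2]
    simp only [h1]
    have h2 := tendsto_integral_of_dominated_convergence (μ := μ)
      (F := fun (n : ℕ) x => ‖(B n).indicator g x - g x‖) (f := fun _ => 0) (fun x => ‖g x‖)
      (fun n => ((hgm.indicator (hB n)).sub hgm).norm.aestronglyMeasurable)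
      (L1.integrable_coeFn g).norm
      (fun n => Filter.Eventually.of_forall fun x => by
        by_cases hx : x ∈ B n <;> simp [hx])
      (Filter.Eventually.of_forall fun x => by
        have h3 : ∀ᶠ n : ℕ in Filter.atTop, x ∈ B n := by
          have h4 : ∀ᶠ n : ℕ in Filter.atTop, |g x| / v x ^ 2 ≤ n :=
            (tendsto_natCast_atTop_atTop (R := ℝ)).eventually_ge_atTop _
          filter_upwards [h4] with n hn
          rwa [div_le_iff₀ (pow_pos (hv0 x) 2)] at hn
        refine tendsto_const_nhds.congr' ?_
        filter_upwards [h3] with n hn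
        simp [hn])
    simpa using h2
  exact tendsto_nhds_unique (((pairing μ f).continuous.tendsto g).comp hGt)
    (((L.continuous.tendsto g).comp hGt).congr fun n => (hvu _).symm)

theorem norm_pairing [SigmaFinite μ] (f : Linf μ) : ‖pairing μ f‖ = ‖f‖ := by
  refine le_antisymm ((pairing μ f).opNorm_le_bound (norm_nonneg _) (abs_pairing_le f)) ?_
  obtain ⟨f', h1, h2⟩ := exists_pairing_eq (pairing μ f)
  rwa [pairing_ext (f := f') (f' := f) fun g => by rw [h1]] at h2

variable (μ) in
/-- The identification of `L^∞` with the dual of `L^1`. -/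
def dualEquiv [SigmaFinite μ] : Linf μ ≃ₗᵢ[ℝ] StrongDual ℝ (Lp ℝ 1 μ) :=
  LinearIsometryEquiv.ofSurjective
    { toLinearMap := (pairing μ).toLinearMap
      norm_map' := norm_pairing } fun L => by
      obtain ⟨f, hf, -⟩ := exists_pairing_eq L
      exact ⟨f, hf⟩

theorem pairing_dualEquiv_symm [SigmaFinite μ] (L : StrongDual ℝ (Lp ℝ 1 μ)) :
    pairing μ ((dualEquiv μ).symm L) = L := (dualEquiv μ).apply_symm_apply L

theorem continuous_weakStar_pairing (g : Lp ℝ 1 μ) :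
    @Continuous _ _ (weakStar μ) _ fun f : Linf μ => pairing μ f g := by
  let := weakStar μ
  simp only [pairing_apply]
  exact continuous_weakStar_iff.1 continuous_id g

end Linf

namespace Linf

variable {X : Type u} [MeasurableSpace X] {μ : Measure X}

/-! ### Bounded operators into `L^∞` -/

variable {V : Type*} [NormedAddCommGroup V] [NormedSpace ℝ V]

/-- Bounded bilinear forms on `V × L^1` are bounded operators from `V` into `L^∞`. -/
theorem exists_operator_of_bilinear [SigmaFinite μ] (b : V →ₗ[ℝ] Lp ℝ 1 μ →ₗ[ℝ] ℝ) {r : ℝ}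
    (hr : 0 ≤ r) (hb : ∀ φ g, |b φ g| ≤ r * ‖φ‖ * ‖g‖) :
    ∃ Φ : V →L[ℝ] Linf μ, ‖Φ‖ ≤ r ∧ ∀ φ g, pairing μ (Φ φ) g = b φ g := by
  let B : V →L[ℝ] StrongDual ℝ (Lp ℝ 1 μ) := b.mkContinuous₂ r hb
  refine ⟨(dualEquiv μ).symm.toContinuousLinearEquiv.toContinuousLinearMap ∘L B, ?_, fun φ g => ?_⟩
  · refine ContinuousLinearMap.opNorm_le_bound _ hr fun φ => ?_
    have h1 : ‖B φ‖ ≤ r * ‖φ‖ :=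
      (B φ).opNorm_le_bound (by positivity) (hb φ)
    exact ((dualEquiv μ).symm.norm_map _).trans_le h1
  · exact DFunLike.congr_fun (pairing_dualEquiv_symm (B φ)) g

/-- Operators bounded by `r` have limits along ultrafilters for pointwise weak* convergence.
This is the form in which the weak* compactness of balls is used below. -/
theorem exists_ultrafilter_limit [SigmaFinite μ] {ι : Type*} (U : Ultrafilter ι)
    (F : ι → V →L[ℝ] Linf μ) {r : ℝ} (hr : 0 ≤ r) (hF : ∀ᶠ i in U, ‖F i‖ ≤ r) :
    ∃ Φ : V →L[ℝ] Linf μ, ‖Φ‖ ≤ r ∧ ∀ φ g,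
      Filter.Tendsto (fun i => pairing μ (F i φ) g) U (𝓝 (pairing μ (Φ φ) g)) := by
  have key : ∀ φ g, ∃ b ∈ Icc (-(r * ‖φ‖ * ‖g‖)) (r * ‖φ‖ * ‖g‖),
      Filter.Tendsto (fun i => pairing μ (F i φ) g) U (𝓝 b) := fun φ g => by
    refine isCompact_Icc.ultrafilter_le_nhds (U.map fun i => pairing μ (F i φ) g) ?_
    refine Filter.le_principal_iff.2 (Filter.mem_map.2 ?_)
    filter_upwards [hF] with i hi
    rw [mem_preimage, mem_Icc, ← abs_le]
    calc |pairing μ (F i φ) g| ≤ ‖F i φ‖ * ‖g‖ := abs_pairing_le _ _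
      _ ≤ r * ‖φ‖ * ‖g‖ := by
        gcongr
        exact ((F i).le_opNorm φ).trans (by gcongr)
  choose b hbI hb using key
  let b' : V →ₗ[ℝ] Lp ℝ 1 μ →ₗ[ℝ] ℝ := LinearMap.mk₂ ℝ b
    (fun φ φ' g => tendsto_nhds_unique (hb _ _)
      (((hb φ g).add (hb φ' g)).congr fun i => by simp))
    (fun c φ g => tendsto_nhds_unique (hb _ _) (((hb φ g).const_smul c).congr fun i => by simp))
    (fun φ g g' => tendsto_nhds_unique (hb _ _)
      (((hb φ g).add (hb φ g')).congr fun i => by simp))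
    (fun c φ g => tendsto_nhds_unique (hb _ _) (((hb φ g).const_smul c).congr fun i => by simp))
  obtain ⟨Φ, hΦ, h⟩ := exists_operator_of_bilinear b' hr fun φ g => abs_le.2 (hbI φ g)
  refine ⟨Φ, hΦ, fun φ g => ?_⟩
  rw [h φ g]
  exact hb φ g

theorem norm_smul_operator_le (f : Linf μ) (δ : V →L[ℝ] Linf μ) : ‖f • δ‖ ≤ ‖f‖ * ‖δ‖ := by
  refine ContinuousLinearMap.opNorm_le_bound _ (by positivity) fun v => ?_
  calc ‖f * δ v‖ ≤ ‖f‖ * ‖δ v‖ := norm_mul_le _ _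
    _ ≤ ‖f‖ * (‖δ‖ * ‖v‖) := by gcongr; exact δ.le_opNorm v
    _ = _ := by ring

/-! ### The pointwise norm of an operator into `L^∞` -/

/-- The values `|δ(v)|` for `v` in the unit ball, whose supremum in `L^∞` is the pointwise norm of
`δ`. -/
def absValues (δ : V →L[ℝ] Linf μ) : Set (Linf μ) := {u | ∃ v : V, ‖v‖ ≤ 1 ∧ u = |δ v|}

theorem exists_isLUB_absValues [SFinite μ] (δ : V →L[ℝ] Linf μ) :
    ∃ u, IsLUB (absValues δ) u := by
  refine exists_isLUB ⟨_, 0, by simp, rfl⟩ (b := ‖δ‖ • (1 : Linf μ)) ?_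
  rintro _ ⟨v, hv, rfl⟩
  rw [le_iff]
  filter_upwards [ae_abs_le_norm (δ v), Lp.coeFn_smul ‖δ‖ (1 : Linf μ), coeFn_one (μ := μ),
    Lp.coeFn_abs (δ v)] with x h1 h2 h3 h4
  rw [h2, Pi.smul_apply, h3, smul_eq_mul, mul_one, h4]
  exact h1.trans (δ.unit_le_opNorm v hv)

/-- The pointwise norm `|δ|` of a bounded operator `δ : V → L^∞`: the supremum in `L^∞` of
`|δ(v)|` over the unit ball of `V`. -/
def absNorm [SFinite μ] (δ : V →L[ℝ] Linf μ) : Linf μ := (exists_isLUB_absValues δ).choose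

theorem isLUB_absNorm [SFinite μ] (δ : V →L[ℝ] Linf μ) : IsLUB (absValues δ) (absNorm δ) :=
  (exists_isLUB_absValues δ).choose_spec

theorem absNorm_nonneg [SFinite μ] (δ : V →L[ℝ] Linf μ) : 0 ≤ absNorm δ :=
  (abs_nonneg _).trans ((isLUB_absNorm δ).1 ⟨0, by simp, rfl⟩)

theorem norm_absNorm [SFinite μ] (δ : V →L[ℝ] Linf μ) : ‖absNorm δ‖ = ‖δ‖ := by
  refine le_antisymm ?_ (δ.opNorm_le_of_unit_norm (norm_nonneg _) fun v hv => ?_)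
  · have h : absNorm δ ≤ ‖δ‖ • (1 : Linf μ) := by
      refine (isLUB_absNorm δ).2 ?_
      rintro _ ⟨v, hv, rfl⟩
      rw [le_iff]
      filter_upwards [ae_abs_le_norm (δ v), Lp.coeFn_smul ‖δ‖ (1 : Linf μ), coeFn_one (μ := μ),
        Lp.coeFn_abs (δ v)] with x h1 h2 h3 h4
      rw [h2, Pi.smul_apply, h3, smul_eq_mul, mul_one, h4]
      exact h1.trans (δ.unit_le_opNorm v hv)
    refine norm_le_of_ae (norm_nonneg _) ?_
    filter_upwards [le_iff.1 h, nonneg_iff.1 (absNorm_nonneg δ),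
      Lp.coeFn_smul ‖δ‖ (1 : Linf μ), coeFn_one (μ := μ)] with x h1 h2 h3 h4
    rw [h3, Pi.smul_apply, h4, smul_eq_mul, mul_one] at h1
    rwa [abs_of_nonneg h2]
  · refine norm_le_norm_of_abs_le ?_
    filter_upwards [le_iff.1 ((isLUB_absNorm δ).1 ⟨v, hv.le, rfl⟩), Lp.coeFn_abs (δ v)]
      with x h1 h2
    rw [h2] at h1
    exact h1.trans (le_abs_self _)

theorem absNorm_smul [SFinite μ] (f : Linf μ) (δ : V →L[ℝ] Linf μ) :
    absNorm (f • δ) = |f| * absNorm δ := by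
  have hfδ : ∀ v, |(f • δ) v| = |f| * |δ v| := fun v => by
    rw [_root_.smul_apply, smul_eq_mul, abs_mul]
  refine (isLUB_absNorm (f • δ)).unique ⟨?_, fun w hw => ?_⟩
  · rintro _ ⟨v, hv, rfl⟩
    rw [hfδ, le_iff]
    filter_upwards [le_iff.1 ((isLUB_absNorm δ).1 ⟨v, hv, rfl⟩), coeFn_mul |f| |δ v|,
      coeFn_mul |f| (absNorm δ), Lp.coeFn_abs f] with x h1 h2 h3 h4
    rw [h2, h3, h4]
    gcongr
  · -- divide the upper bound `w` by `|f|` where `f` does not vanish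
    have hfm : Measurable f := (Lp.stronglyMeasurable f).measurable
    have hNm : Measurable (absNorm δ) := (Lp.stronglyMeasurable (absNorm δ)).measurable
    have hwm : Measurable w := (Lp.stronglyMeasurable w).measurable
    have hv : ∀ v, ‖v‖ ≤ 1 → ∀ᵐ x ∂μ, |f x| * |δ v x| ≤ w x := fun v hv => by
      filter_upwards [le_iff.1 (hw ⟨v, hv, rfl⟩), Lp.coeFn_abs ((f • δ) v),
        coeFn_mul f (δ v)] with x h1 h2 h3
      rw [h2, _root_.smul_apply, smul_eq_mul, h3, _root_.abs_mul] at h1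
      exact h1
    have hw0 : ∀ᵐ x ∂μ, 0 ≤ w x := by
      filter_upwards [hv 0 (by simp)] with x hx
      exact (by positivity : (0 : ℝ) ≤ _).trans hx
    let u : X → ℝ := fun x => if f x = 0 then absNorm δ x else min (absNorm δ x) (w x / |f x|)
    have hum : Measurable u := Measurable.ite (hfm (measurableSet_singleton 0)) hNm
      (hNm.min (hwm.div hfm.abs))
    have hub : ∀ᵐ x ∂μ, |u x| ≤ ‖absNorm δ‖ := by
      filter_upwards [nonneg_iff.1 (absNorm_nonneg δ), ae_abs_le_norm (absNorm δ), hw0]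
        with x h1 h2 h3
      refine le_trans ?_ h2
      simp only [u]
      split_ifs
      · rfl
      · rw [abs_of_nonneg h1, abs_of_nonneg (le_min h1 (by positivity))]
        exact min_le_left _ _
    obtain ⟨u', hu'⟩ := exists_coeFn_eq hum.aestronglyMeasurable _ hub
    have h : absNorm δ ≤ u' := by
      refine (isLUB_absNorm δ).2 ?_
      rintro _ ⟨v, hv1, rfl⟩
      rw [le_iff]
      filter_upwards [hu', hv v hv1, le_iff.1 ((isLUB_absNorm δ).1 ⟨v, hv1, rfl⟩),
        Lp.coeFn_abs (δ v)] with x h1 h2 h3 h4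
      rw [h1]
      simp only [u]
      split_ifs with h0
      · exact h3
      · refine le_min h3 ?_
        rw [h4, le_div_iff₀ (abs_pos.2 h0), mul_comm]
        exact h2
    rw [le_iff]
    filter_upwards [le_iff.1 h, hu', hw0, coeFn_mul |f| (absNorm δ), Lp.coeFn_abs f]
      with x h1 h2 h3 h4 h5
    rw [h4, h5]
    rw [h2] at h1
    simp only [u] at h1
    split_ifs at h1 with h0
    · simpa [h0] using h3
    · have := h1.trans (min_le_right _ _)
      rwa [le_div_iff₀ (abs_pos.2 h0), mul_comm] at this

end Linf

/-! ### Dual modules and reflexivity -/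

namespace DualModule

variable {X : Type u} [MeasurableSpace X] {μ : Measure X}
  {E : Type u} [NormedAddCommGroup E] [NormedSpace ℝ E] [Module (Linf μ) E]

/-- A bounded module homomorphism into `L^∞` as an element of the dual module. -/
def mk (Φ : E →L[ℝ] Linf μ) (h : ∀ (f : Linf μ) (φ : E), Φ (f • φ) = f * Φ φ) : DualModule μ E :=
  ⟨Φ, h⟩

@[simp] theorem mk_apply (Φ : E →L[ℝ] Linf μ) (h) (φ : E) : (mk Φ h : DualModule μ E) φ = Φ φ :=
  rfl

theorem ext {Φ Ψ : DualModule μ E} (h : ∀ φ, Φ φ = Ψ φ) : Φ = Ψ :=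
  Subtype.ext (ContinuousLinearMap.ext h)

theorem map_smul (Φ : DualModule μ E) (f : Linf μ) (φ : E) : Φ (f • φ) = f * Φ φ := Φ.2 f φ

@[simp] theorem add_apply (Φ Ψ : DualModule μ E) (φ : E) : (Φ + Ψ) φ = Φ φ + Ψ φ := rfl

@[simp] theorem smul_apply (f : Linf μ) (Φ : DualModule μ E) (φ : E) : (f • Φ) φ = f * Φ φ := rfl

@[simp] theorem real_smul_apply (c : ℝ) (Φ : DualModule μ E) (φ : E) : (c • Φ) φ = c • Φ φ := rfl

theorem norm_apply_le (Φ : DualModule μ E) (φ : E) : ‖Φ φ‖ ≤ ‖Φ‖ * ‖φ‖ := Φ.1.le_opNorm φ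

theorem norm_smul_le (f : Linf μ) (Φ : DualModule μ E) : ‖f • Φ‖ ≤ ‖f‖ * ‖Φ‖ :=
  Linf.norm_smul_operator_le f Φ.1

/-- Evaluation at a vector as a linear map on the dual module. -/
def applyₗ (φ : E) : DualModule μ E →ₗ[Linf μ] Linf μ where
  toFun Φ := Φ φ
  map_add' _ _ := rfl
  map_smul' _ _ := rfl

theorem sum_apply {ι : Type*} (s : Finset ι) (Φ : ι → DualModule μ E) (φ : E) :
    (∑ i ∈ s, Φ i) φ = ∑ i ∈ s, Φ i φ := map_sum (applyₗ φ) Φ s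

/-- The elements of the dual module are linear over `L^∞`. -/
def toLinearMap (Φ : DualModule μ E) : E →ₗ[Linf μ] Linf μ where
  toFun φ := Φ φ
  map_add' := Φ.1.map_add
  map_smul' := Φ.2

theorem toLinearMap_apply (Φ : DualModule μ E) (φ : E) : Φ.toLinearMap φ = Φ φ := rfl

theorem map_sum' {ι : Type*} (Φ : DualModule μ E) (s : Finset ι) (φ : ι → E) :
    Φ (∑ i ∈ s, φ i) = ∑ i ∈ s, Φ (φ i) := map_sum Φ.toLinearMap φ s

/-- The natural map from `E` into its second dual module, as a bounded operator. -/
def eval : E →L[ℝ] DualModule μ (DualModule μ E) :=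
  LinearMap.mkContinuous
    { toFun := fun φ => mk (LinearMap.mkContinuous
        { toFun := fun Φ : DualModule μ E => Φ φ
          map_add' := fun _ _ => rfl
          map_smul' := fun _ _ => rfl } ‖φ‖ fun Φ => by
            rw [mul_comm]; exact norm_apply_le Φ φ) fun _ _ => rfl
      map_add' := fun φ ψ => ext fun Φ => Φ.1.map_add φ ψ
      map_smul' := fun c φ => ext fun Φ => Φ.1.map_smul c φ } 1 fun φ => by
    rw [one_mul]
    exact ContinuousLinearMap.opNorm_le_bound _ (norm_nonneg φ) fun Φ => by
      rw [mul_comm]; exact norm_apply_le Φ φ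

@[simp] theorem eval_apply (φ : E) (Φ : DualModule μ E) : (eval φ) Φ = Φ φ := rfl

theorem norm_eval_le (φ : E) : ‖(eval φ : DualModule μ (DualModule μ E))‖ ≤ ‖φ‖ :=
  ContinuousLinearMap.opNorm_le_bound _ (norm_nonneg φ) fun Φ => by
    rw [mul_comm]; exact norm_apply_le Φ φ

theorem isBanachModule [SFinite μ] : IsBanachModule μ (DualModule μ E) where
  complete := by
    have hc : IsClosed ((dualSubmodule μ E : Set (E →L[ℝ] Linf μ))) := by
      have h : (dualSubmodule μ E : Set (E →L[ℝ] Linf μ))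
          = ⋂ (f : Linf μ) (φ : E), {Φ | Φ (f • φ) = f * Φ φ} := by
        ext Φ
        simp only [mem_iInter]
        rfl
      rw [h]
      refine isClosed_iInter fun f => isClosed_iInter fun φ => isClosed_eq ?_ ?_
      · exact (ContinuousLinearMap.apply ℝ (Linf μ) (f • φ)).continuous
      · exact continuous_const.mul (ContinuousLinearMap.apply ℝ (Linf μ) φ).continuous
    exact hc.completeSpace_coe
  isScalarTower := ⟨fun c f Φ => ext fun φ => smul_mul_assoc c f (Φ φ)⟩
  norm_smul_le := norm_smul_le

/-- A dual module `E'` is reflexive as soon as every element of `E''` is locally evaluation at an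
element of `E`. Indeed an element `T` of `E'''` restricts on `E` to an element `φ` of `E'`,
and `T - ev_φ` vanishes on `E`. -/
theorem isReflexiveModule
    (H : ∀ (Ψ : DualModule μ (DualModule μ E)) (h : Linf μ), h ≠ 0 →
      ∃ (q : Linf μ) (φ : E), q * h ≠ 0 ∧ q • Ψ = eval φ) :
    IsReflexiveModule μ (DualModule μ E) := by
  intro T
  have heval : ∀ (f : Linf μ) (φ : E), (eval (f • φ) : DualModule μ (DualModule μ E))
      = f • eval φ := fun f φ => ext fun Φ => Φ.map_smul f φ
  let Φ : DualModule μ E := mk (T.1 ∘L eval) fun f φ => by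
    rw [ContinuousLinearMap.comp_apply, heval]
    exact T.map_smul f _
  refine ⟨Φ, fun Ψ => ?_⟩
  by_contra hne
  obtain ⟨q, φ, hq, hφ⟩ := H Ψ (T Ψ - Ψ Φ) (sub_ne_zero.2 hne)
  apply hq
  rw [mul_sub, ← T.map_smul, ← smul_apply, hφ]
  exact sub_self _

/-- Bounded module maps are bounded pointwise: `|Φ(φ)| ≤ ‖Φ‖ |φ|`. This follows from the bound at
the vectors `(|φ| + ε)⁻¹ φ`. -/
theorem ae_abs_apply_le {N : E → Linf μ} (hN : IsPointwiseNorm μ N) (Φ : DualModule μ E) (φ : E) :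
    ∀ᵐ x ∂μ, |Φ φ x| ≤ ‖Φ‖ * N φ x := by
  have hNm : Measurable (N φ) := (Lp.stronglyMeasurable (N φ)).measurable
  have hN0 := Linf.nonneg_iff.1 (hN.nonneg φ)
  have key : ∀ n : ℕ, ∀ᵐ x ∂μ, |Φ φ x| ≤ ‖Φ‖ * (N φ x + 1 / ((n : ℝ) + 1)) := fun n => by
    have hε : (0 : ℝ) < 1 / ((n : ℝ) + 1) := Nat.one_div_pos_of_nat
    set ε : ℝ := 1 / ((n : ℝ) + 1)
    obtain ⟨h, hh⟩ := Linf.exists_coeFn_eq (μ := μ) (f := fun x => (N φ x + ε)⁻¹)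
      (hNm.add_const ε).inv.aestronglyMeasurable ε⁻¹ (by
        filter_upwards [hN0] with x hx
        rw [abs_of_nonneg (by positivity)]
        gcongr
        linarith)
    have h1 : ‖h • φ‖ ≤ 1 := by
      rw [hN.norm_eq, hN.smul]
      refine Linf.norm_le_of_ae zero_le_one ?_
      filter_upwards [hh, hN0, Linf.coeFn_mul |h| (N φ), Lp.coeFn_abs h] with x h1 h2 h3 h4
      rw [h3, h4, h1, abs_of_nonneg (by positivity), abs_of_nonneg (by positivity), inv_mul_eq_div,
        div_le_one (by positivity)]
      linarith
    have h2 : ‖h * Φ φ‖ ≤ ‖Φ‖ := by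
      rw [← Φ.map_smul]
      exact (Φ.norm_apply_le _).trans (mul_le_of_le_one_right (norm_nonneg _) h1)
    filter_upwards [Linf.ae_abs_le_norm (h * Φ φ), Linf.coeFn_mul h (Φ φ), hh, hN0]
      with x h3 h4 h5 h6
    have h7 : 0 < N φ x + ε := by positivity
    rw [h4, h5, abs_mul, abs_of_pos (inv_pos.2 h7), inv_mul_eq_div] at h3
    exact (div_le_iff₀ h7).1 (h3.trans h2)
  filter_upwards [ae_all_iff.2 key] with x hx
  have h1 : Filter.Tendsto (fun n : ℕ => ‖Φ‖ * (N φ x + 1 / ((n : ℝ) + 1))) Filter.atTop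
      (𝓝 (‖Φ‖ * (N φ x + 0))) :=
    (tendsto_const_nhds.add tendsto_one_div_add_atTop_nhds_zero_nat).const_mul _
  simpa using ge_of_tendsto' h1 hx

end DualModule

/-- Bounded families in a dual module have limits along ultrafilters for pointwise weak*
convergence. -/
theorem DualModule.exists_ultrafilter_limit {X : Type u} [MeasurableSpace X] {μ : Measure X}
    [SigmaFinite μ] {E : Type u} [NormedAddCommGroup E] [NormedSpace ℝ E] [Module (Linf μ) E]
    {ι : Type*} (U : Ultrafilter ι) (F : ι → DualModule μ E) {r : ℝ} (hr : 0 ≤ r)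
    (hF : ∀ᶠ i in U, ‖F i‖ ≤ r) :
    ∃ Φ : DualModule μ E, ‖Φ‖ ≤ r ∧ ∀ φ g,
      Filter.Tendsto (fun i => Linf.pairing μ (F i φ) g) U (𝓝 (Linf.pairing μ (Φ φ) g)) := by
  obtain ⟨Φ, hΦ, h⟩ := Linf.exists_ultrafilter_limit U (fun i => (F i).1) hr hF
  refine ⟨DualModule.mk Φ fun f φ => Linf.pairing_ext fun g => ?_, hΦ, h⟩
  rw [Linf.pairing_mul]
  refine tendsto_nhds_unique (h _ g) ((h φ (f • g : Lp ℝ 1 μ)).congr fun i => ?_)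
  rw [← Linf.pairing_mul, ← (F i).map_smul]

namespace MeasurablePseudometric

variable {X : Type u} [MeasurableSpace X] {μ : Measure X} {d : MeasurablePseudometric μ}

/-! ### Weak* continuity of derivations -/

/-- Weak* convergence to `f` of an ultrafilter on the unit ball of `Lip(M)`. -/
structure BoundedWeakStarLimit (U : Ultrafilter (Lip d)) (f : Lip d) : Prop where
  norm_le : ‖f‖ ≤ 1
  eventually_norm_le : ∀ᶠ f' in (U : Filter (Lip d)), ‖f'‖ ≤ 1
  tendsto : ∀ g, Filter.Tendsto (fun f' => Linf.pairing μ (Lip.incl d f') g) U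
    (𝓝 (Linf.pairing μ (Lip.incl d f) g))

/-- The predual of `Lip(M)` consists of the functionals which respect bounded weak* limits. -/
theorem mem_lipPredual_iff (ℓ : StrongDual ℝ (Lip d)) :
    ℓ ∈ d.lipPredual ↔ ∀ U f, BoundedWeakStarLimit U f → Filter.Tendsto ℓ U (𝓝 (ℓ f)) := by
  let τ : TopologicalSpace (Lip d) :=
    TopologicalSpace.induced (Lip.incl d) (Linf.weakStar μ)
  have hnhds : ∀ (U : Ultrafilter (Lip d)) (f : Lip d), (U : Filter (Lip d)) ≤ @nhds _ τ f ↔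
      ∀ g, Filter.Tendsto (fun f' => Linf.pairing μ (Lip.incl d f') g) U
        (𝓝 (Linf.pairing μ (Lip.incl d f) g)) := fun U f => by
    rw [@nhds_induced _ _ (Linf.weakStar μ), nhds_induced, Filter.comap_comap,
      ← Filter.tendsto_iff_comap, tendsto_pi_nhds]
    simp only [Linf.pairing_apply]
    exact Iff.rfl
  constructor
  · rintro h U f ⟨h1, h2, h3⟩
    have h4 := h f (by simpa using h1)
    refine Filter.Tendsto.mono_left h4 (le_inf ((hnhds U f).2 h3) ?_)
    exact Filter.le_principal_iff.2 (by filter_upwards [h2] with f' hf'; simpa using hf')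
  · intro h f hf
    refine Filter.tendsto_iff_ultrafilter _ _ _ |>.2 fun U hU => h U f ⟨by simpa using hf, ?_, ?_⟩
    · filter_upwards [Filter.le_principal_iff.1 (hU.trans inf_le_right)] with f' hf'
      simpa using hf'
    · exact (hnhds U f).1 (hU.trans inf_le_left)

theorem mem_metricDerivations_iff (δ : Lip d →L[ℝ] Linf μ) :
    δ ∈ d.metricDerivations ↔
      (∀ U f, BoundedWeakStarLimit U f → ∀ g, Filter.Tendsto (fun f' => Linf.pairing μ (δ f') g) U
        (𝓝 (Linf.pairing μ (δ f) g))) ∧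
      ∀ f g : Lip d, δ (f * g) = Lip.incl d f * δ g + Lip.incl d g * δ f := by
  refine and_congr_left fun _ => ⟨fun h U f hU g => ?_, fun h => ?_⟩
  · let τ := d.lipWeakStar
    have h1 : Continuous fun f => Linf.pairing μ (δ f) g := by
      simp only [Linf.pairing_apply]
      exact Linf.continuous_weakStar_iff.1 h g
    refine (h1.tendsto f).mono_left ?_
    rw [nhds_induced, ← Filter.tendsto_iff_comap, tendsto_pi_nhds]
    exact fun ℓ => (mem_lipPredual_iff ℓ.1).1 ℓ.2 U f hU
  · have hℓ : ∀ g, ((Linf.pairing μ).flip g ∘L δ : StrongDual ℝ (Lip d)) ∈ d.lipPredual :=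
      fun g => (mem_lipPredual_iff _).2 fun U f hU => h U f hU g
    have hτ : ∀ ℓ : d.lipPredual, @Continuous _ _ d.lipWeakStar _ fun f : Lip d => ℓ.1 f :=
      fun ℓ => 
        @continuous_pi_iff _ _ _ d.lipWeakStar _ (fun (f : Lip d) (ℓ : d.lipPredual) => ℓ.1 f)
          |>.1 continuous_induced_dom ℓ
    let _ := d.lipWeakStar
    refine Linf.continuous_weakStar_iff.2 fun g => (hτ ⟨_, hℓ g⟩).congr fun f => ?_
    exact Linf.pairing_apply _ _

theorem isClosed_metricDerivations :
    IsClosed (d.metricDerivations : Set (Lip d →L[ℝ] Linf μ)) := by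
  refine isClosed_of_closure_subset fun δ hδ => ?_
  refine (mem_metricDerivations_iff δ).2 ⟨fun U f hU g => ?_, fun f g => ?_⟩
  · rw [Metric.tendsto_nhds]
    intro ε hε
    have hη : 0 < ε / (3 * (‖g‖ + 1)) := by positivity
    obtain ⟨δ', hδ', hd⟩ := Metric.mem_closure_iff.1 hδ _ hη
    have h1 := ((mem_metricDerivations_iff δ').1 hδ').1 U f hU g
    rw [Metric.tendsto_nhds] at h1
    have key : ∀ f' : Lip d, ‖f'‖ ≤ 1 →
        |Linf.pairing μ (δ f') g - Linf.pairing μ (δ' f') g| ≤ ε / 3 := fun f' hf' => by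
      have h2 : Linf.pairing μ (δ f') g - Linf.pairing μ (δ' f') g
          = Linf.pairing μ ((δ - δ') f') g := by simp
      rw [h2]
      calc _ ≤ ‖(δ - δ') f'‖ * ‖g‖ := Linf.abs_pairing_le _ _
        _ ≤ ε / (3 * (‖g‖ + 1)) * (‖g‖ + 1) := by
          gcongr
          · rw [dist_eq_norm] at hd
            exact ((δ - δ').unit_le_opNorm f' hf').trans hd.le
          · linarith
        _ = ε / 3 := by field_simp
    filter_upwards [h1 (ε / 3) (by positivity), hU.eventually_norm_le] with f' h2 h3
    have h4 := key f' h3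
    have h5 := key f hU.norm_le
    rw [Real.dist_eq] at h2 ⊢
    rw [abs_le] at h4 h5
    rw [abs_lt] at h2 ⊢
    constructor <;> linarith [h2.1, h2.2, h4.1, h4.2, h5.1, h5.2]
  · have hc : IsClosed {δ : Lip d →L[ℝ] Linf μ |
        δ (f * g) = Lip.incl d f * δ g + Lip.incl d g * δ f} := by
      have h (v : Lip d) : Continuous fun δ : Lip d →L[ℝ] Linf μ => δ v :=
        (ContinuousLinearMap.apply ℝ (Linf μ) v).continuous
      exact isClosed_eq (h _) ((continuous_const.mul (h _)).add (continuous_const.mul (h _)))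
    exact closure_minimal (fun δ hδ => hδ.2 f g) hc hδ

/-! ### Vector fields and differentials -/

namespace VectorFields

theorem ext {δ δ' : d.VectorFields} (h : ∀ f, δ f = δ' f) : δ = δ' :=
  Subtype.ext (ContinuousLinearMap.ext h)

@[simp] theorem smul_apply (h : Linf μ) (δ : d.VectorFields) (f : Lip d) : (h • δ) f = h * δ f :=
  rfl

theorem norm_apply_le (δ : d.VectorFields) (f : Lip d) : ‖δ f‖ ≤ ‖δ‖ * ‖f‖ := δ.1.le_opNorm f

theorem norm_smul_le (f : Linf μ) (δ : d.VectorFields) : ‖f • δ‖ ≤ ‖f‖ * ‖δ‖ :=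
  Linf.norm_smul_operator_le f δ.1

theorem isBanachModule : IsBanachModule μ d.VectorFields where
  complete := isClosed_metricDerivations.completeSpace_coe
  isScalarTower := ⟨fun c f δ => ext fun g => smul_mul_assoc c f (δ g)⟩
  norm_smul_le := norm_smul_le

/-- The supremum of `|δ(f)|` over the unit ball of `Lip(M)` is a pointwise norm. -/
theorem isPointwiseNorm [SFinite μ] :
    IsPointwiseNorm μ fun δ : d.VectorFields => Linf.absNorm δ.1 where
  nonneg δ := Linf.absNorm_nonneg δ.1
  norm_eq δ := (Linf.norm_absNorm δ.1).symm
  smul f δ := Linf.absNorm_smul f δ.1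

/-- The differential `df` of a Lipschitz function, `df(δ) = δ(f)`. -/
def differential (d : MeasurablePseudometric μ) : Lip d →L[ℝ] d.OneForms :=
  LinearMap.mkContinuous
    { toFun := fun f => DualModule.mk (LinearMap.mkContinuous
        { toFun := fun δ : d.VectorFields => δ f
          map_add' := fun _ _ => rfl
          map_smul' := fun _ _ => rfl } ‖f‖ fun δ => by
            rw [mul_comm]; exact norm_apply_le δ f) fun _ _ => rfl
      map_add' := fun f g => DualModule.ext fun δ => δ.1.map_add f g
      map_smul' := fun c f => DualModule.ext fun δ => δ.1.map_smul c f } 1 fun f => by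
    rw [one_mul]
    exact ContinuousLinearMap.opNorm_le_bound _ (norm_nonneg f) fun δ => by
      rw [mul_comm]; exact norm_apply_le δ f

@[simp] theorem differential_apply (f : Lip d) (δ : d.VectorFields) :
    (differential d f) δ = δ f := rfl

theorem norm_differential_le (f : Lip d) : ‖differential d f‖ ≤ ‖f‖ :=
  ContinuousLinearMap.opNorm_le_bound _ (norm_nonneg f) fun δ => by
    rw [mul_comm]; exact norm_apply_le δ f

/-- If the module of 1-forms is reflexive, then every bounded module map `T` on it restricts to a
vector field `f ↦ T(df)`. For the weak* continuity, let `f' → f` weak* in the unit ball. The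
functionals `T ↦ T(df')` have a limit in `Ω''`, which is evaluation at some `ω` by reflexivity;
testing on vector fields gives `ω = df`. -/
theorem comp_differential_mem [SigmaFinite μ] (hR : IsReflexiveModule μ d.OneForms)
    (T : DualModule μ d.OneForms) : T.1 ∘L differential d ∈ d.metricDerivations := by
  refine (mem_metricDerivations_iff _).2 ⟨fun U f hU => ?_, fun f g => ?_⟩
  · obtain ⟨L, -, hL⟩ := DualModule.exists_ultrafilter_limit (E := DualModule μ d.OneForms) U
      (fun f' => DualModule.eval (differential d f')) zero_le_one (by
        filter_upwards [hU.eventually_norm_le] with f' hf'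
        exact (DualModule.norm_eval_le _).trans ((norm_differential_le f').trans hf'))
    obtain ⟨ω, hω⟩ := hR L
    have h : ω = differential d f := DualModule.ext fun δ => Linf.pairing_ext fun g => by
      have h1 := hL (DualModule.eval δ) g
      rw [hω] at h1
      exact tendsto_nhds_unique h1 (((mem_metricDerivations_iff δ.1).1 δ.2).1 U f hU g)
    intro g
    have h2 := hL T g
    rw [hω, h] at h2
    exact h2
  · have h : differential d (f * g)
        = Lip.incl d f • differential d g + Lip.incl d g • differential d f :=
      DualModule.ext fun δ => δ.2.2 f g
    change T (differential d (f * g)) = Lip.incl d f * T (differential d g)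
      + Lip.incl d g * T (differential d f)
    rw [h, ← T.map_smul, ← T.map_smul]
    exact T.1.map_add _ _

/-- The vector field `f ↦ T(df)`. -/
def ofBidual [SigmaFinite μ] (hR : IsReflexiveModule μ d.OneForms) (T : DualModule μ d.OneForms) :
    d.VectorFields := ⟨T.1 ∘L differential d, comp_differential_mem hR T⟩

theorem ofBidual_apply [SigmaFinite μ] (hR : IsReflexiveModule μ d.OneForms)
    (T : DualModule μ d.OneForms) (f : Lip d) : (ofBidual hR T) f = T (differential d f) := rfl

theorem norm_ofBidual_le [SigmaFinite μ] (hR : IsReflexiveModule μ d.OneForms)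
    (T : DualModule μ d.OneForms) : ‖ofBidual hR T‖ ≤ ‖T‖ :=
  ContinuousLinearMap.opNorm_le_bound _ (norm_nonneg T) fun f =>
    (T.norm_apply_le _).trans (by gcongr; exact norm_differential_le f)

theorem exists_ultrafilter_limit [SigmaFinite μ] (hR : IsReflexiveModule μ d.OneForms)
    {ι : Type*} (U : Ultrafilter ι) (δ : ι → d.VectorFields) {r : ℝ} (hr : 0 ≤ r)
    (hδ : ∀ᶠ i in U, ‖δ i‖ ≤ r) :
    ∃ ε : d.VectorFields, ‖ε‖ ≤ r ∧ ∀ f g,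
      Filter.Tendsto (fun i => Linf.pairing μ (δ i f) g) U (𝓝 (Linf.pairing μ (ε f) g)) := by
  obtain ⟨T, hT, h⟩ := DualModule.exists_ultrafilter_limit (E := d.OneForms) U
    (fun i => DualModule.eval (δ i)) hr (by
      filter_upwards [hδ] with i hi
      exact (DualModule.norm_eval_le _).trans hi)
  exact ⟨ofBidual hR T, (norm_ofBidual_le hR T).trans hT, fun f g => h (differential d f) g⟩

end VectorFields

end MeasurablePseudometric

/-! ### The predual of the module of vector fields -/

/-- `L^1` embeds isometrically into the dual of `L^∞`. -/
theorem Linf.norm_pairing_flip {X : Type u} [MeasurableSpace X] {μ : Measure X} [SigmaFinite μ]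
    (g : Lp ℝ 1 μ) : ‖(Linf.pairing μ).flip g‖ = ‖g‖ := by
  refine le_antisymm (ContinuousLinearMap.opNorm_le_bound _ (norm_nonneg _) fun f => ?_)
    (NormedSpace.norm_le_dual_bound ℝ g (norm_nonneg _) fun L => ?_)
  · rw [mul_comm]; exact Linf.abs_pairing_le f g
  · obtain ⟨f, rfl, hf⟩ := Linf.exists_pairing_eq L
    exact (((Linf.pairing μ).flip g).le_opNorm f).trans (by gcongr)

namespace MeasurablePseudometric.VectorFields

variable {X : Type u} [MeasurableSpace X] {μ : Measure X} {d : MeasurablePseudometric μ}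

/-- The functional `δ ↦ ∫ ω(δ) g` on `𝒳(M)`. -/
def weakFunctional (ω : d.OneForms) (g : Lp ℝ 1 μ) : StrongDual ℝ d.VectorFields :=
  (Linf.pairing μ).flip g ∘L ω.1

theorem weakFunctional_apply (ω : d.OneForms) (g : Lp ℝ 1 μ) (δ : d.VectorFields) :
    weakFunctional ω g δ = Linf.pairing μ (ω δ) g := rfl

theorem norm_weakFunctional_le (ω : d.OneForms) (g : Lp ℝ 1 μ) :
    ‖weakFunctional ω g‖ ≤ ‖ω‖ * ‖g‖ := by
  refine ContinuousLinearMap.opNorm_le_bound _ (by positivity) fun δ => ?_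
  calc ‖Linf.pairing μ (ω δ) g‖ ≤ ‖ω δ‖ * ‖g‖ := Linf.abs_pairing_le _ _
    _ ≤ ‖ω‖ * ‖δ‖ * ‖g‖ := by gcongr; exact ω.norm_apply_le δ
    _ = _ := by ring

variable (d) in
/-- The predual of `𝒳(M)`: the closed linear span of the functionals `δ ↦ ∫ δ(f) g`. -/
def predual : Submodule ℝ (StrongDual ℝ d.VectorFields) :=
  (Submodule.span ℝ (range fun p : Lip d × Lp ℝ 1 μ =>
    weakFunctional (differential d p.1) p.2)).topologicalClosure

theorem weakFunctional_mem_predual (f : Lip d) (g : Lp ℝ 1 μ) :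
    weakFunctional (differential d f) g ∈ predual d :=
  Submodule.le_topologicalClosure _ (Submodule.subset_span ⟨(f, g), rfl⟩)

/-- A closed subspace which contains the functionals `δ ↦ ∫ δ(f) g` contains the predual. -/
theorem predual_le {S : Submodule ℝ (StrongDual ℝ d.VectorFields)}
    (hS : IsClosed (S : Set (StrongDual ℝ d.VectorFields)))
    (h : ∀ f g, weakFunctional (differential d f) g ∈ S) : predual d ≤ S :=
  Submodule.topologicalClosure_minimal _
    (Submodule.span_le.2 (by rintro _ ⟨p, rfl⟩; exact h p.1 p.2)) hS

/-- The predual of `𝒳(M)` as a normed space of its own. -/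
def Predual (d : MeasurablePseudometric μ) : Type u := predual d

instance : NormedAddCommGroup (Predual d) := inferInstanceAs (NormedAddCommGroup (predual d))

instance : NormedSpace ℝ (Predual d) := inferInstanceAs (NormedSpace ℝ (predual d))

instance : CompleteSpace (Predual d) :=
  have h : IsClosed (predual d : Set (StrongDual ℝ d.VectorFields)) :=
    Submodule.isClosed_topologicalClosure _
  h.completeSpace_coe

/-- The inclusion of the predual into the dual Banach space of `𝒳(M)`. -/
def Predual.incl (d : MeasurablePseudometric μ) : Predual d →ₗᵢ[ℝ] StrongDual ℝ d.VectorFields :=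
  (predual d).subtypeₗᵢ

/-- The action of a vector field on the predual. -/
def toDualPredual (d : MeasurablePseudometric μ) :
    d.VectorFields →ₗ[ℝ] StrongDual ℝ (Predual d) where
  toFun δ := NormedSpace.inclusionInDoubleDual ℝ d.VectorFields δ ∘L
    (Predual.incl d).toContinuousLinearMap
  map_add' δ ε := by ext v; simp
  map_smul' c δ := by ext v; simp

theorem toDualPredual_apply (δ : d.VectorFields) (v : Predual d) :
    toDualPredual d δ v = v.1 δ := rfl

theorem norm_toDualPredual [SigmaFinite μ] (δ : d.VectorFields) : ‖toDualPredual d δ‖ = ‖δ‖ := by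
  refine le_antisymm (ContinuousLinearMap.opNorm_le_bound _ (norm_nonneg _) fun v => ?_)
    (ContinuousLinearMap.opNorm_le_bound _ (norm_nonneg _) fun f => ?_)
  · rw [toDualPredual_apply, mul_comm]
    exact v.1.le_opNorm δ
  · rw [← Linf.norm_pairing]
    refine ContinuousLinearMap.opNorm_le_bound _ (by positivity) fun g => ?_
    calc ‖toDualPredual d δ ⟨_, weakFunctional_mem_predual f g⟩‖
        ≤ ‖toDualPredual d δ‖ * ‖weakFunctional (differential d f) g‖ :=
          (toDualPredual d δ).le_opNorm _
      _ ≤ ‖toDualPredual d δ‖ * (‖f‖ * ‖g‖) := by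
        gcongr
        exact (norm_weakFunctional_le _ g).trans (by gcongr; exact norm_differential_le f)
      _ = _ := by ring

/-- A functional on the predual extends to `𝒳(M)'`, and the extension induces an element of
`Ω(M)'`, hence a vector field. -/
theorem toDualPredual_surjective [SigmaFinite μ] (hR : IsReflexiveModule μ d.OneForms) :
    Function.Surjective (toDualPredual d) := by
  intro L
  obtain ⟨L', hL', -⟩ := exists_extension_norm_eq (predual d) L
  let b : d.OneForms →ₗ[ℝ] Lp ℝ 1 μ →ₗ[ℝ] ℝ :=
    LinearMap.mk₂ ℝ (fun ω g => L' (weakFunctional ω g))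
      (fun ω ω' g => by
        rw [← map_add]; congr 1; ext δ
        simp [weakFunctional_apply])
      (fun c ω g => by
        rw [← map_smul]; congr 1; ext δ
        simp [weakFunctional_apply])
      (fun ω g g' => by
        rw [← map_add]; congr 1; ext δ
        simp [weakFunctional_apply])
      (fun c ω g => by
        rw [← map_smul]; congr 1; ext δ
        simp [weakFunctional_apply])
  obtain ⟨T, -, hT⟩ := Linf.exists_operator_of_bilinear b (norm_nonneg L') fun ω g => by
    refine (L'.le_opNorm _).trans ?_
    rw [mul_assoc]
    gcongr
    exact norm_weakFunctional_le ω g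
  have hTm : ∀ (f : Linf μ) (ω : d.OneForms), T (f • ω) = f * T ω := fun f ω =>
    Linf.pairing_ext fun g => by
      rw [hT, Linf.pairing_mul, hT]
      change L' _ = L' _
      congr 1
      ext δ
      rw [weakFunctional_apply, weakFunctional_apply, ← Linf.pairing_mul]
      rfl
  refine ⟨ofBidual hR (DualModule.mk T hTm), ?_⟩
  have hS : predual d ≤ LinearMap.ker
      ((NormedSpace.inclusionInDoubleDual ℝ d.VectorFields (ofBidual hR (DualModule.mk T hTm))
        - L').toLinearMap) := by
    refine predual_le (ContinuousLinearMap.isClosed_ker _) fun f g => ?_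
    rw [LinearMap.mem_ker]
    change weakFunctional _ _ _ - _ = 0
    rw [weakFunctional_apply, differential_apply, ofBidual_apply, DualModule.mk_apply, hT]
    exact sub_self _
  ext v
  exact (sub_eq_zero.1 (hS v.2)).trans (hL' v)

/-- If the module of 1-forms is reflexive, then `𝒳(M)` is the dual space of its predual. -/
def predualEquiv [SigmaFinite μ] (hR : IsReflexiveModule μ d.OneForms) :
    d.VectorFields ≃ₗᵢ[ℝ] StrongDual ℝ (Predual d) :=
  LinearIsometryEquiv.ofSurjective
    { toLinearMap := toDualPredual d, norm_map' := norm_toDualPredual }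
    (toDualPredual_surjective hR)

theorem continuous_weakStarOf_apply {E F : Type u} [NormedAddCommGroup E] [NormedSpace ℝ E]
    [NormedAddCommGroup F] [NormedSpace ℝ F] (e : E ≃ₗᵢ[ℝ] StrongDual ℝ F) (v : F) :
    @Continuous _ _ (weakStarOf e) _ fun φ => e φ v :=
  @continuous_pi_iff _ _ _ (weakStarOf e) _ (fun (φ : E) (v : F) => e φ v)
    |>.1 continuous_induced_dom v

/-- If the module of 1-forms is reflexive, then the module of vector fields is an abelian
W*-module. -/
theorem isAbelianWStarModule [SigmaFinite μ] (hR : IsReflexiveModule μ d.OneForms) :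
    IsAbelianWStarModule μ d.VectorFields := by
  refine ⟨⟨isBanachModule, _, isPointwiseNorm⟩, Predual d, inferInstance, inferInstance, inferInstance,
    predualEquiv hR, fun φ => ?_, fun f => ?_⟩
  · -- the functional `f ↦ v(f φ)` is in the closed subspace `L^1` of the dual of `L^∞`
    let J : Lp ℝ 1 μ →ₗᵢ[ℝ] StrongDual ℝ (Linf μ) :=
      { toLinearMap := (Linf.pairing μ).flip.toLinearMap
        norm_map' := Linf.norm_pairing_flip }
    let R : Linf μ →L[ℝ] d.VectorFields :=
      LinearMap.mkContinuous
        { toFun := fun f => f • φ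
          map_add' := fun f g => add_smul f g φ
          map_smul' := fun c f => isBanachModule.isScalarTower.smul_assoc c f φ } ‖φ‖
        fun f => by rw [mul_comm]; exact norm_smul_le f φ
    let Q : StrongDual ℝ d.VectorFields →L[ℝ] StrongDual ℝ (Linf μ) :=
      (ContinuousLinearMap.compL ℝ (Linf μ) d.VectorFields ℝ).flip R
    have hJ : IsClosed (range J) := J.isometry.isClosedEmbedding.isClosed_range
    have hS : predual d ≤ (LinearMap.range J.toLinearMap).comap Q.toLinearMap := by
      refine predual_le (hJ.preimage Q.continuous) fun f g => ?_
      refine ⟨(φ f • g : Lp ℝ 1 μ), ?_⟩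
      ext h
      exact (Linf.pairing_mul' h (φ f) g).symm
    refine @continuous_induced_rng _ _ _ _ _ (_) _ |>.2 (@continuous_pi_iff _ _ _ (_) _ _ |>.2 ?_)
    intro v
    obtain ⟨g, hg⟩ := hS v.2
    have h := Linf.continuous_weakStar_pairing g
    refine @Continuous.congr _ _ (_) _ _ _ h fun f => ?_
    exact DFunLike.congr_fun hg f
  · let M : d.VectorFields →L[ℝ] d.VectorFields :=
      LinearMap.mkContinuous
        { toFun := fun φ => f • φ
          map_add' := fun φ ψ => smul_add f φ ψ
          map_smul' := fun c φ => VectorFields.ext fun h => mul_smul_comm c f (φ h) } ‖f‖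
        fun φ => norm_smul_le f φ
    let Q : StrongDual ℝ d.VectorFields →L[ℝ] StrongDual ℝ d.VectorFields :=
      (ContinuousLinearMap.compL ℝ d.VectorFields d.VectorFields ℝ).flip M
    have hS : predual d ≤ (predual d).comap Q.toLinearMap := by
      refine predual_le ((Submodule.isClosed_topologicalClosure _).preimage Q.continuous)
        fun h g => ?_
      have : Q (weakFunctional (differential d h) g)
          = weakFunctional (differential d h) (f • g : Lp ℝ 1 μ) := by
        ext δ
        exact Linf.pairing_mul f (δ h) g
      rw [Submodule.mem_comap]
      exact this ▸ weakFunctional_mem_predual h _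
    refine @continuous_induced_rng _ _ _ _ _ (_) _ |>.2 (@continuous_pi_iff _ _ _ (_) _ _ |>.2 ?_)
    intro v
    let w : Predual d := ⟨Q v.1, hS v.2⟩
    exact @Continuous.congr _ _ (_) _ _ _ (continuous_weakStarOf_apply (predualEquiv hR) w)
      fun φ => rfl

end MeasurablePseudometric.VectorFields

/-! ### Modules of locally finite rank -/

namespace DualModule

variable {X : Type u} [MeasurableSpace X] {μ : Measure X}
  {E : Type u} [NormedAddCommGroup E] [NormedSpace ℝ E] [Module (Linf μ) E]

/-- A biorthogonal system over the set with characteristic function `q`: the restrictions of the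
vectors `v i` to this set form a partial basis, with coordinates in `W`. -/
structure IsBiorthogonal (W : Submodule (Linf μ) (DualModule μ E)) {k : ℕ} (q : Linf μ)
    (v : Fin k → E) (Φ : Fin k → DualModule μ E) : Prop where
  idempotent : q * q = q
  ne_zero : q ≠ 0
  mem : ∀ i, Φ i ∈ W
  apply_eq : ∀ i j, Φ j (v i) = if i = j then q else 0

/-- A vector on which `W` does not vanish, and which is annihilated by the coordinates of a
biorthogonal system, extends this system over a smaller set. -/
theorem IsBiorthogonal.exists_extension {W : Submodule (Linf μ) (DualModule μ E)} {k : ℕ}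
    {q : Linf μ} {v : Fin k → E} {Φ : Fin k → DualModule μ E} (h : IsBiorthogonal W q v Φ) {x : E}
    (hqx : q • x = x) (hx : ∀ i, Φ i x = 0) {ω : DualModule μ E} (hω : ω ∈ W) (hne : ω x ≠ 0) :
    ∃ (q' : Linf μ) (v' : Fin (k + 1) → E) (Φ' : Fin (k + 1) → DualModule μ E),
      q' * q = q' ∧ IsBiorthogonal W q' v' Φ' := by
  obtain ⟨c, q', hq', hq'0, hc⟩ := Linf.exists_mul_eq_idempotent hne
  have hqq : q' * q = q' := by
    have : q * ω x = ω x := by rw [← ω.map_smul, hqx]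
    rw [← hc, mul_assoc, mul_comm _ q, this]
  let ω' : DualModule μ E := (q' * c) • (ω + (-1 : Linf μ) • ∑ i, (ω (v i)) • Φ i)
  have hω' : ∀ y, ω' y = q' * c * (ω y - ∑ i, ω (v i) * Φ i y) := fun y => by
    simp only [ω', smul_apply, add_apply, sum_apply]
    ring
  refine ⟨q', Fin.snoc v x, Fin.snoc (fun i => q' • Φ i) ω', hqq, hq', hq'0, ?_, ?_⟩
  · refine Fin.lastCases ?_ fun i => ?_
    · rw [Fin.snoc_last]
      exact W.smul_mem _ (W.add_mem hω (W.smul_mem _ (W.sum_mem fun i _ =>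
        W.smul_mem _ (h.mem i))))
    · rw [Fin.snoc_castSucc]
      exact W.smul_mem _ (h.mem i)
  · refine Fin.lastCases ?_ fun i => ?_ <;> refine Fin.lastCases ?_ fun j => ?_
    · simp only [Fin.snoc_last, hω', hx, mul_zero, Finset.sum_const_zero, sub_zero, if_true]
      rw [mul_assoc, hc, hq']
    · simp [hx, (Fin.castSucc_lt_last j).ne']
    · simp only [Fin.snoc_last, Fin.snoc_castSucc, hω', h.apply_eq, mul_ite, mul_zero,
        Finset.sum_ite_eq, Finset.mem_univ, if_true, (Fin.castSucc_lt_last i).ne, if_false]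
      calc q' * c * (ω (v i) - ω (v i) * q) = (q' - q' * q) * (c * ω (v i)) := by ring
        _ = 0 := by rw [hqq, sub_self, zero_mul]
    · simp only [Fin.snoc_castSucc, smul_apply, h.apply_eq, mul_ite, mul_zero,
        Fin.castSucc_inj, hqq]

/-- If the size of biorthogonal systems is bounded, then locally every vector is a combination of
the vectors of a maximal system. -/
theorem exists_isBiorthogonal_generating {W : Submodule (Linf μ) (DualModule μ E)}
    (hW : ∀ x : E, (∀ ω ∈ W, ω x = 0) → x = 0) {n : ℕ}
    (hn : ∀ (k : ℕ) (q : Linf μ) (v : Fin k → E) (Φ : Fin k → DualModule μ E),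
      IsBiorthogonal W q v Φ → k ≤ n) {p : Linf μ} (hp : p * p = p) (hp0 : p ≠ 0) :
    ∃ (k : ℕ) (q : Linf μ) (v : Fin k → E) (Φ : Fin k → DualModule μ E),
      q * p = q ∧ q ≠ 0 ∧ ∀ x, q • x = ∑ i, (q * Φ i x) • v i := by
  let P : ℕ → Prop := fun k => ∃ (q : Linf μ) (v : Fin k → E) (Φ : Fin k → DualModule μ E),
    q * p = q ∧ IsBiorthogonal W q v Φ
  have h0 : P 0 := ⟨p, Fin.elim0, Fin.elim0, hp, hp, hp0, fun i => i.elim0, fun i => i.elim0⟩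
  obtain ⟨k, ⟨q, v, Φ, hqp, h⟩, hk⟩ : ∃ k, P k ∧ ¬ P (k + 1) := by
    by_contra! hc
    have hall : ∀ k, P k := fun k => by
      induction k with
      | zero => exact h0
      | succ k ih => exact hc k ih
    obtain ⟨q, v, Φ, -, h⟩ := hall (n + 1)
    exact absurd (hn _ q v Φ h) (by omega)
  refine ⟨k, q, v, Φ, hqp, h.ne_zero, fun x => ?_⟩
  let y : E := q • (q • x - ∑ i, Φ i x • v i)
  have hqy : q • y = y := by simp only [y, smul_smul, h.idempotent]
  have hy : ∀ i, Φ i y = 0 := fun i => by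
    have h1 : Φ i (q • x - ∑ j, Φ j x • v j) = q * Φ i x - ∑ j, Φ j x * Φ i (v j) := by
      rw [← toLinearMap_apply, map_sub, map_sum]
      simp only [toLinearMap_apply, map_smul]
    simp only [y]
    rw [map_smul, h1]
    simp only [h.apply_eq, mul_ite, mul_zero, Finset.sum_ite_eq', Finset.mem_univ, if_true]
    ring
  have hy0 : y = 0 := by
    refine hW y fun ω hω => ?_
    by_contra hne
    obtain ⟨q', v', Φ', hq', h'⟩ := h.exists_extension hqy hy hω hne
    exact hk ⟨q', v', Φ', by rw [← hq', mul_assoc, hqp], h'⟩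
  simp only [y, smul_sub, smul_smul, h.idempotent, Finset.smul_sum] at hy0
  exact sub_eq_zero.1 hy0

/-- A module has a reflexive dual if it is locally of finite rank, with a bound on the rank. -/
theorem isReflexiveModule_of_bounded_rank {W : Submodule (Linf μ) (DualModule μ E)}
    (hW : ∀ x : E, (∀ ω ∈ W, ω x = 0) → x = 0) {n : ℕ}
    (hn : ∀ (k : ℕ) (q : Linf μ) (v : Fin k → E) (Φ : Fin k → DualModule μ E),
      IsBiorthogonal W q v Φ → k ≤ n) : IsReflexiveModule μ (DualModule μ E) := by
  refine isReflexiveModule fun Ψ h hh => ?_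
  obtain ⟨c, p, hp, hp0, hc⟩ := Linf.exists_mul_eq_idempotent hh
  obtain ⟨k, q, v, Φ, hqp, hq0, hx⟩ := exists_isBiorthogonal_generating hW hn hp hp0
  refine ⟨q, ∑ i, (q * Ψ (Φ i)) • v i, fun h0 => hq0 ?_, ext fun ω => ?_⟩
  · rw [← hqp, ← hc, mul_left_comm, h0, mul_zero]
  · have h1 : q • ω = ∑ i, (q * ω (v i)) • Φ i := ext fun x => by
      rw [smul_apply, ← ω.map_smul, hx, ω.map_sum', sum_apply]
      refine Finset.sum_congr rfl fun i _ => ?_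
      rw [ω.map_smul, smul_apply]
      ring
    rw [smul_apply, ← Ψ.map_smul, h1, Ψ.map_sum', eval_apply, ω.map_sum']
    refine Finset.sum_congr rfl fun i _ => ?_
    rw [Ψ.map_smul, ω.map_smul]
    ring

end DualModule

/-! ### Finitely generated modules of vector fields -/

namespace MeasurablePseudometric.VectorFields

variable {X : Type u} [MeasurableSpace X] {μ : Measure X} {d : MeasurablePseudometric μ}

variable (d) in
/-- The module of 1-forms generated by the differentials of Lipschitz functions. -/
def exactSpan : Submodule (Linf μ) d.OneForms := Submodule.span (Linf μ) (range (differential d))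

theorem continuous_of_mem_exactSpan {ω : d.OneForms} (hω : ω ∈ exactSpan d) (g : Lp ℝ 1 μ) :
    @Continuous _ _ d.pointwiseWeakStar _ fun δ : d.VectorFields => Linf.pairing μ (ω δ) g := by
  let _ := d.pointwiseWeakStar
  induction hω using Submodule.span_induction generalizing g with
  | mem ω h =>
    obtain ⟨f, rfl⟩ := h
    have h1 : Continuous fun δ : d.VectorFields => ∫ x, δ f x * g x ∂μ :=
      @continuous_pi_iff _ _ _ d.pointwiseWeakStar _
        (fun (δ : d.VectorFields) (p : Lip d × Lp ℝ 1 μ) => ∫ x, δ p.1 x * p.2 x ∂μ)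
        |>.1 continuous_induced_dom (f, g)
    exact h1.congr fun δ => (Linf.pairing_apply _ _).symm
  | zero =>
    have h0 : ∀ δ : d.VectorFields, (0 : d.OneForms) δ = 0 := fun _ => rfl
    simp only [h0, map_zero, _root_.zero_apply]
    exact continuous_const
  | add ω ω' _ _ h h' =>
    simp only [DualModule.add_apply, map_add, _root_.add_apply]
    exact (h g).add (h' g)
  | smul c ω _ h =>
    simp only [DualModule.smul_apply, Linf.pairing_mul]
    exact h _

/-- Forms in the span of the differentials are determined by their values on a dense set. -/
theorem apply_eq_zero_of_dense [SigmaFinite μ] {ω : d.OneForms} (hω : ω ∈ exactSpan d)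
    {S : Set d.VectorFields} (hS : @Dense _ d.pointwiseWeakStar S) (h : ∀ δ ∈ S, ω δ = 0)
    (δ : d.VectorFields) : ω δ = 0 := by
  refine Linf.pairing_ext fun g => ?_
  let _ := d.pointwiseWeakStar
  have h1 := (continuous_of_mem_exactSpan hω g).ext_on hS
    (continuous_const (y := Linf.pairing μ 0 g)) fun δ hδ => by
      simp only [h δ hδ]
  exact congrFun h1 δ

/-- If `𝒳(M)` is generated by the finite set `S`, then all minors of size `|S| + 1` vanish. By
weak* density, this may be checked one row after the other on combinations of elements of `S`. -/
theorem det_eq_zero_of_dense [SigmaFinite μ] [DecidableEq d.VectorFields]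
    {S : Finset d.VectorFields}
    (hS : @Dense _ d.pointwiseWeakStar
      (Submodule.span (Linf μ) (S : Set d.VectorFields) : Set d.VectorFields))
    (v : Option S → d.VectorFields) {Φ : Option S → d.OneForms} (hΦ : ∀ j, Φ j ∈ exactSpan d) :
    (Matrix.of fun i j => Φ j (v i)).det = 0 := by
  suffices H : ∀ (t : Finset (Option S)) (v : Option S → d.VectorFields),
      (∀ i ∉ t, v i ∈ Submodule.span (Linf μ) (S : Set d.VectorFields)) →
      (Matrix.of fun i j => Φ j (v i)).det = 0 from
    H Finset.univ v fun i hi => (hi (Finset.mem_univ i)).elim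
  intro t
  induction t using Finset.induction_on with
  | empty =>
    intro v hv
    have hv' : ∀ i, ∃ c : d.VectorFields → Linf μ, ∑ s : S, c s • (s : d.VectorFields) = v i :=
      fun i => by
        obtain ⟨c, -, hc⟩ := Submodule.mem_span_finset.1 (hv i (Finset.notMem_empty i))
        exact ⟨c, by rw [← hc, ← Finset.sum_coe_sort S]⟩
    choose c hc using hv'
    -- the matrix factors through `S`; a zero column makes the left factor square
    let C : Matrix (Option S) (Option S) (Linf μ) :=
      Matrix.of fun i o => o.elim 0 fun s => c i s
    let D : Matrix (Option S) (Option S) (Linf μ) :=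
      Matrix.of fun o j => o.elim 0 fun s => Φ j s
    have hCD : (Matrix.of fun i j => Φ j (v i)) = C * D := by
      ext i j : 1
      rw [Matrix.mul_apply, Fintype.sum_option]
      simp only [C, D, Matrix.of_apply, Option.elim, zero_mul, zero_add]
      rw [← hc i, (Φ j).map_sum']
      exact Finset.sum_congr rfl fun s _ => (Φ j).map_smul _ _
    rw [hCD, Matrix.det_mul, Matrix.det_eq_zero_of_column_eq_zero none fun i => rfl, zero_mul]
  | insert a t _ ih =>
    intro v hv
    let L : (Option S → Linf μ) →ₗ[Linf μ] Linf μ :=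
      (Matrix.detRowAlternating (n := Option S) (R := Linf μ)).toMultilinearMap.toLinearMap
        (fun i j => Φ j (v i)) a
    have hL : ∀ x, L (fun j => Φ j x)
        = (Matrix.of fun i j => Φ j (Function.update v a x i)).det := fun x => by
      change (Matrix.of (Function.update (fun i j => Φ j (v i)) a fun j => Φ j x)).det = _
      congr 2
      ext i j : 2
      by_cases hi : i = a
      · subst hi; simp
      · simp [hi]
    let ω : d.OneForms := ∑ j, L (fun i => if j = i then 1 else 0) • Φ j
    have hω : ∀ x, ω x = L fun j => Φ j x := fun x => by
      rw [L.pi_apply_eq_sum_univ, DualModule.sum_apply]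
      exact Finset.sum_congr rfl fun j _ => mul_comm _ _
    have h1 := apply_eq_zero_of_dense (ω := ω)
      (Submodule.sum_mem _ fun j _ => Submodule.smul_mem _ _ (hΦ j)) hS (fun x hx => by
        rw [hω, hL]
        refine ih _ fun i hi => ?_
        by_cases hia : i = a
        · subst hia; simpa using hx
        · rw [Function.update_of_ne hia]
          exact hv i (by simp [hia, hi])) (v a)
    rwa [hω, hL, Function.update_eq_self] at h1

/-- If `𝒳(M)` is finitely generated, then the module of 1-forms is reflexive. -/
theorem isReflexiveModule_of_finitelyGenerated [SigmaFinite μ]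
    (h : d.VectorFieldsFinitelyGenerated) : IsReflexiveModule μ d.OneForms := by
  classical
  obtain ⟨S, hS⟩ := h
  refine DualModule.isReflexiveModule_of_bounded_rank (W := exactSpan d) (n := S.card)
    (fun δ hδ => ext fun f => hδ _ (Submodule.subset_span ⟨f, rfl⟩)) fun k q v Φ hB => ?_
  by_contra hk
  obtain ⟨e⟩ : Nonempty (Option S ↪ Fin k) := by
    refine Function.Embedding.nonempty_of_card_le ?_
    simp only [Fintype.card_option, Fintype.card_coe, Fintype.card_fin]
    omega
  have h1 := det_eq_zero_of_dense hS (v ∘ e) (Φ := Φ ∘ e) fun j => hB.mem _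
  have h2 : (Matrix.of fun i j => (Φ ∘ e) j ((v ∘ e) i))
      = q • (1 : Matrix (Option S) (Option S) (Linf μ)) := by
    ext i j : 1
    simp [hB.apply_eq, Matrix.one_apply]
  rw [h2, Matrix.det_smul, Matrix.det_one, mul_one] at h1
  have h3 : ∀ m : ℕ, q ^ (m + 1) = q := fun m => by
    induction m with
    | zero => exact pow_one q
    | succ m ih => rw [pow_succ, ih, hB.idempotent]
  rw [Fintype.card_option, h3] at h1
  exact hB.ne_zero h1

end MeasurablePseudometric.VectorFields

namespace Linf

variable {X : Type u} [MeasurableSpace X] {μ : Measure X}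

/-! ### A faithful positive functional on `L^∞` -/

theorem zero_le_one' : (0 : Linf μ) ≤ 1 := by
  rw [nonneg_iff]
  filter_upwards [coeFn_one (μ := μ)] with x hx
  rw [hx]
  exact zero_le_one

theorem abs_mul_abs_self' (f : Linf μ) : |f| * |f| = f * f := by
  rw [ext_iff]
  filter_upwards [coeFn_mul |f| |f|, coeFn_mul f f, Lp.coeFn_abs f] with x h1 h2 h3
  rw [h1, h2, h3, abs_mul_abs_self]

theorem mul_self_nonneg' (f : Linf μ) : 0 ≤ f * f := by
  rw [nonneg_iff]
  filter_upwards [coeFn_mul f f] with x h1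
  rw [h1]
  exact mul_self_nonneg _

theorem integrable_toFinite [SFinite μ] (f : Linf μ) : Integrable f μ.toFinite :=
  Integrable.of_bound (C := ‖f‖)
    ((aestronglyMeasurable f).mono_ac (toFinite_absolutelyContinuous μ))
    (by rw [ae_toFinite]; simpa using ae_abs_le_norm f)

variable (μ) in
/-- Integration against a finite measure with the same null sets. -/
def mean [SFinite μ] : Linf μ →L[ℝ] ℝ :=
  LinearMap.mkContinuous
    { toFun := fun f => ∫ x, f x ∂μ.toFinite
      map_add' := fun f g => by
        rw [← integral_add (integrable_toFinite f) (integrable_toFinite g)]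
        refine integral_congr_ae ?_
        change ∀ᵐ x ∂_, _
        rw [ae_toFinite]
        exact Lp.coeFn_add f g
      map_smul' := fun c f => by
        rw [RingHom.id_apply, smul_eq_mul, ← integral_const_mul]
        refine integral_congr_ae ?_
        change ∀ᵐ x ∂_, _
        rw [ae_toFinite]
        exact Lp.coeFn_smul c f } (μ.toFinite.real univ) fun f => by
    rw [mul_comm]
    refine norm_integral_le_of_norm_le_const ?_
    rw [ae_toFinite]
    simpa using ae_abs_le_norm f

theorem mean_apply [SFinite μ] (f : Linf μ) : mean μ f = ∫ x, f x ∂μ.toFinite := rfl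

theorem mean_nonneg [SFinite μ] {f : Linf μ} (hf : 0 ≤ f) : 0 ≤ mean μ f :=
  integral_nonneg_of_ae (by
    change ∀ᵐ x ∂_, _
    rw [ae_toFinite]
    exact nonneg_iff.1 hf)

theorem mean_mono [SFinite μ] {f g : Linf μ} (h : f ≤ g) : mean μ f ≤ mean μ g := by
  rw [← sub_nonneg, ← map_sub]
  exact mean_nonneg (sub_nonneg.2 h)

theorem eq_zero_of_mean_mul_self [SFinite μ] {f : Linf μ} (h : mean μ (f * f) = 0) : f = 0 := by
  have h0 : ∀ᵐ x ∂μ.toFinite, 0 ≤ (f * f) x := by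
    rw [ae_toFinite]; exact nonneg_iff.1 (mul_self_nonneg' f)
  rw [mean_apply, integral_eq_zero_iff_of_nonneg_ae h0 (integrable_toFinite _)] at h
  have h' : ∀ᵐ x ∂μ, (f * f) x = 0 := by rw [← ae_toFinite]; exact h
  rw [eq_zero_iff]
  filter_upwards [h', coeFn_mul f f] with x h1 h2
  rw [h2] at h1
  exact mul_self_eq_zero.1 h1

/-- The Cauchy–Schwarz inequality for the functional `mean`. -/
theorem sq_mean_le [SFinite μ] (f : Linf μ) : mean μ f ^ 2 ≤ mean μ 1 * mean μ (f * f) := by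
  have h := discrim_le_zero (a := mean μ 1) (b := -2 * mean μ f) (c := mean μ (f * f)) fun t => by
    have h1 := mean_nonneg (mul_self_nonneg' (f - t • (1 : Linf μ)))
    have h2 : (f - t • (1 : Linf μ)) * (f - t • (1 : Linf μ))
        = f * f - (2 * t) • f + (t * t) • (1 : Linf μ) := by
      simp only [sub_mul, mul_sub, smul_mul_assoc, mul_smul_comm, mul_one, one_mul]
      module
    rw [h2, map_add, map_sub, _root_.map_smul, _root_.map_smul, smul_eq_mul, smul_eq_mul] at h1
    linarith
  rw [discrim] at h
  linarith

end Linf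

/-! ### Jordan–von Neumann theorem for modules -/

section JordanVonNeumann

variable {X : Type u} [MeasurableSpace X] {μ : Measure X}
  {E : Type u} [NormedAddCommGroup E] {N : E → Linf μ}

/-- Polarization of the square of a pointwise norm. -/
def polarization (N : E → Linf μ) (φ ψ : E) : Linf μ :=
  (4⁻¹ : ℝ) • (N (φ + ψ) ^ 2 - N (φ - ψ) ^ 2)

theorem ae_abs_polarization_le
    (hP : ∀ φ ψ, N (φ + ψ) ^ 2 + N (φ - ψ) ^ 2 = 2 * N φ ^ 2 + 2 * N ψ ^ 2) (φ ψ : E) :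
    ∀ᵐ x ∂μ, 2 * |polarization N φ ψ x| ≤ (N φ ^ 2 : Linf μ) x + (N ψ ^ 2 : Linf μ) x := by
  have h0 : ∀ φ, ∀ᵐ x ∂μ, 0 ≤ (N φ ^ 2 : Linf μ) x := fun φ => by
    rw [sq]; exact Linf.nonneg_iff.1 (Linf.mul_self_nonneg' _)
  have h1 := hP φ ψ
  have h2 : N (φ + ψ) ^ 2 + N (φ - ψ) ^ 2 = (2 : ℝ) • (N φ ^ 2 + N ψ ^ 2) := by
    rw [h1, Algebra.smul_def, map_ofNat]; ring
  have h3 := Linf.ext_iff.1 h2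
  filter_upwards [h0 (φ + ψ), h0 (φ - ψ), h3, Lp.coeFn_add (N (φ + ψ) ^ 2) (N (φ - ψ) ^ 2),
    Lp.coeFn_smul (2 : ℝ) (N φ ^ 2 + N ψ ^ 2), Lp.coeFn_add (N φ ^ 2) (N ψ ^ 2),
    Lp.coeFn_smul (4⁻¹ : ℝ) (N (φ + ψ) ^ 2 - N (φ - ψ) ^ 2),
    Lp.coeFn_sub (N (φ + ψ) ^ 2) (N (φ - ψ) ^ 2)] with x k1 k2 k3 k4 k5 k6 k7 k8
  rw [k4, k5, Pi.smul_apply, k6, Pi.add_apply, Pi.add_apply, smul_eq_mul] at k3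
  have k9 : polarization N φ ψ x
      = 4⁻¹ * ((N (φ + ψ) ^ 2 : Linf μ) x - (N (φ - ψ) ^ 2 : Linf μ) x) := by
    rw [polarization, k7, Pi.smul_apply, k8, Pi.sub_apply, smul_eq_mul]
  rw [k9, abs_mul, abs_of_pos (by norm_num : (0 : ℝ) < 4⁻¹)]
  have : |(N (φ + ψ) ^ 2 : Linf μ) x - (N (φ - ψ) ^ 2 : Linf μ) x|
      ≤ (N (φ + ψ) ^ 2 : Linf μ) x + (N (φ - ψ) ^ 2 : Linf μ) x := by
    rw [abs_le]; constructor <;> linarith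
  linarith

variable [Module (Linf μ) E]

theorem IsPointwiseNorm.sq_smul (hN : IsPointwiseNorm μ N) (f : Linf μ) (φ : E) :
    N (f • φ) ^ 2 = f * f * N φ ^ 2 := by
  rw [hN.smul, mul_pow, sq |f|, Linf.abs_mul_abs_self']

theorem IsPointwiseNorm.sq_neg (hN : IsPointwiseNorm μ N) (φ : E) : N (-φ) ^ 2 = N φ ^ 2 := by
  rw [← neg_one_smul (Linf μ) φ, hN.sq_smul]
  ring

theorem polarization_symm (hN : IsPointwiseNorm μ N) (φ ψ : E) :
    polarization N φ ψ = polarization N ψ φ := by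
  rw [polarization, polarization, add_comm φ ψ, ← neg_sub ψ φ, hN.sq_neg]

theorem polarization_self (hN : IsPointwiseNorm μ N) (φ : E) :
    polarization N φ φ = N φ ^ 2 := by
  have h0 : N (0 : E) ^ 2 = 0 := by
    rw [← zero_smul (Linf μ) (0 : E), hN.sq_smul]; ring
  have h2 : N (φ + φ) ^ 2 = (4 : ℝ) • N φ ^ 2 := by
    rw [← two_smul (Linf μ) φ, hN.sq_smul, Algebra.smul_def, map_ofNat]
    ring
  rw [polarization, sub_self, h0, h2, sub_zero, smul_smul]
  norm_num

variable [NormedSpace ℝ E]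

theorem polarization_add_left (hN : IsPointwiseNorm μ N)
    (hP : ∀ φ ψ, N (φ + ψ) ^ 2 + N (φ - ψ) ^ 2 = 2 * N φ ^ 2 + 2 * N ψ ^ 2) (u v z : E) :
    polarization N (u + v) z = polarization N u z + polarization N v z := by
  have e1 := hP ((2⁻¹ : ℝ) • (u + v) + z) ((2⁻¹ : ℝ) • (u - v))
  have e2 := hP ((2⁻¹ : ℝ) • (u + v) - z) ((2⁻¹ : ℝ) • (u - v))
  have e3 := hP ((2⁻¹ : ℝ) • (u + v) + z) ((2⁻¹ : ℝ) • (u + v))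
  have e4 := hP ((2⁻¹ : ℝ) • (u + v) - z) ((2⁻¹ : ℝ) • (u + v))
  have r1 : (2⁻¹ : ℝ) • (u + v) + z + (2⁻¹ : ℝ) • (u - v) = u + z := by module
  have r2 : (2⁻¹ : ℝ) • (u + v) + z - (2⁻¹ : ℝ) • (u - v) = v + z := by module
  have r3 : (2⁻¹ : ℝ) • (u + v) - z + (2⁻¹ : ℝ) • (u - v) = u - z := by module
  have r4 : (2⁻¹ : ℝ) • (u + v) - z - (2⁻¹ : ℝ) • (u - v) = v - z := by module
  have r5 : (2⁻¹ : ℝ) • (u + v) + z + (2⁻¹ : ℝ) • (u + v) = u + v + z := by module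
  have r6 : (2⁻¹ : ℝ) • (u + v) + z - (2⁻¹ : ℝ) • (u + v) = z := by module
  have r7 : (2⁻¹ : ℝ) • (u + v) - z + (2⁻¹ : ℝ) • (u + v) = u + v - z := by module
  have r8 : (2⁻¹ : ℝ) • (u + v) - z - (2⁻¹ : ℝ) • (u + v) = -z := by module
  rw [r1, r2] at e1
  rw [r3, r4] at e2
  rw [r5, r6] at e3
  rw [r7, r8, hN.sq_neg] at e4
  rw [polarization, polarization, polarization, ← smul_add]
  congr 1
  linear_combination e3 - e4 - e1 + e2

/-- Homogeneity of the polarization. Additivity gives homogeneity over `ℚ`, hence a bound for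
`⟨fφ, ψ⟩ - r ⟨φ, ψ⟩` for rational constants `r`, in which `r` may tend to the value of `f` at a
point. -/
theorem polarization_smul_left (hE : IsBanachModule μ E) (hN : IsPointwiseNorm μ N)
    (hP : ∀ φ ψ, N (φ + ψ) ^ 2 + N (φ - ψ) ^ 2 = 2 * N φ ^ 2 + 2 * N ψ ^ 2) (f : Linf μ)
    (φ ψ : E) : polarization N (f • φ) ψ = f * polarization N φ ψ := by
  have := hE.isScalarTower
  let B : E →+ Linf μ :=
    AddMonoidHom.mk' (fun φ => polarization N φ ψ) fun u v => polarization_add_left hN hP u v ψ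
  have hrat : ∀ (r : ℚ) (u : E), polarization N ((r : ℝ) • u) ψ = (r : ℝ) • polarization N u ψ :=
    fun r u => map_ratCast_smul B ℝ ℝ r u
  have hsub : ∀ u v : E, polarization N (u - v) ψ = polarization N u ψ - polarization N v ψ :=
    fun u v => map_sub B u v
  have key : ∀ (r : ℚ) (n : ℕ), ∀ᵐ x ∂μ,
      2 * ((n : ℝ) * |polarization N (f • φ) ψ x - r * polarization N φ ψ x|)
        ≤ ((n : ℝ) * (f x - r)) ^ 2 * (N φ ^ 2 : Linf μ) x + (N ψ ^ 2 : Linf μ) x := fun r n => by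
    let c : Linf μ := ((n : ℚ) : ℝ) • (f - (r : ℝ) • (1 : Linf μ))
    have h1 : polarization N (c • φ) ψ
        = ((n : ℚ) : ℝ) • (polarization N (f • φ) ψ - (r : ℝ) • polarization N φ ψ) := by
      simp only [c]
      rw [smul_assoc, hrat, sub_smul, hsub, smul_assoc, one_smul, hrat]
    have h2 := ae_abs_polarization_le hP (c • φ) ψ
    rw [h1, hN.sq_smul] at h2
    filter_upwards [h2, Linf.coeFn_mul (c * c) (N φ ^ 2), Linf.coeFn_mul c c,
      Lp.coeFn_smul ((n : ℚ) : ℝ) (f - (r : ℝ) • (1 : Linf μ)),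
      Lp.coeFn_sub f ((r : ℝ) • (1 : Linf μ)), Lp.coeFn_smul (r : ℝ) (1 : Linf μ),
      Linf.coeFn_one (μ := μ),
      Lp.coeFn_smul ((n : ℚ) : ℝ) (polarization N (f • φ) ψ - (r : ℝ) • polarization N φ ψ),
      Lp.coeFn_sub (polarization N (f • φ) ψ) ((r : ℝ) • polarization N φ ψ),
      Lp.coeFn_smul (r : ℝ) (polarization N φ ψ)] with x k1 k2 k3 k4 k5 k6 k7 k8 k9 k10
    rw [k2, k3, k4, Pi.smul_apply, k5, Pi.sub_apply, k6, Pi.smul_apply, k7, k8, Pi.smul_apply, k9,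
      Pi.sub_apply, k10, Pi.smul_apply] at k1
    simp only [smul_eq_mul, mul_one, abs_mul, Rat.cast_natCast, Nat.abs_cast] at k1
    rw [sq]
    exact k1
  rw [Linf.ext_iff]
  filter_upwards [ae_all_iff.2 fun r => ae_all_iff.2 (key r),
    Linf.coeFn_mul f (polarization N φ ψ)] with x hx hm
  rw [hm]
  have hreal : ∀ (r : ℝ) (n : ℕ),
      2 * ((n : ℝ) * |polarization N (f • φ) ψ x - r * polarization N φ ψ x|)
        ≤ ((n : ℝ) * (f x - r)) ^ 2 * (N φ ^ 2 : Linf μ) x + (N ψ ^ 2 : Linf μ) x := fun r n => by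
    refine isClosed_property (p := fun r : ℝ =>
      2 * ((n : ℝ) * |polarization N (f • φ) ψ x - r * polarization N φ ψ x|)
        ≤ ((n : ℝ) * (f x - r)) ^ 2 * (N φ ^ 2 : Linf μ) x + (N ψ ^ 2 : Linf μ) x)
      Rat.denseRange_cast (isClosed_le (by fun_prop) (by fun_prop)) (fun q => hx q n) r
  have hf := hreal (f x)
  simp only [sub_self, mul_zero, zero_pow two_ne_zero, zero_mul, zero_add] at hf
  by_contra hne
  have hpos : 0 < |polarization N (f • φ) ψ x - f x * polarization N φ ψ x| :=
    abs_pos.2 (sub_ne_zero.2 hne)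
  obtain ⟨n, hn⟩ := exists_nat_gt ((N ψ ^ 2 : Linf μ) x
    / |polarization N (f • φ) ψ x - f x * polarization N φ ψ x|)
  rw [div_lt_iff₀ hpos] at hn
  have := hf n
  have h0 : 0 < (n : ℝ) * |polarization N (f • φ) ψ x - f x * polarization N φ ψ x| := by
    rcases Nat.eq_zero_or_pos n with h | h
    · subst h
      have h1 := hf 0
      simp only [Nat.cast_zero, zero_mul, mul_zero] at hn h1
      exact absurd hn (not_lt.2 h1)
    · positivity
  linarith

/-- A Banach module whose pointwise norm satisfies the parallelogram law is a Hilbert module. -/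
def HilbertModuleStructure.ofParallelogram (hE : IsBanachModule μ E) (hN : IsPointwiseNorm μ N)
    (hP : ∀ φ ψ, N (φ + ψ) ^ 2 + N (φ - ψ) ^ 2 = 2 * N φ ^ 2 + 2 * N ψ ^ 2) :
    HilbertModuleStructure μ E where
  isBanachModule := hE
  inner := polarization N
  symm := polarization_symm hN
  add_left := polarization_add_left hN hP
  smul_left := polarization_smul_left hE hN hP
  nonneg φ := by rw [polarization_self hN, sq]; exact Linf.mul_self_nonneg' _
  norm_sq φ := by rw [polarization_self hN, sq (N φ), Linf.norm_mul_self, hN.norm_eq]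

theorem ParallelogramLaw.exists_hilbertModuleStructure (hP : ParallelogramLaw μ E)
    (hE : IsBanachModule μ E) (hN : IsPointwiseNorm μ N) :
    ∃ H : HilbertModuleStructure μ E, ∀ φ, H.inner φ φ = N φ * N φ :=
  ⟨.ofParallelogram hE hN (hP N hN), fun φ => (polarization_self hN φ).trans (sq _)⟩

end JordanVonNeumann

/-! ### Self-duality -/

/-- A functional `ℓ` bounded by the seminorm of a positive bilinear form `b` is represented by a
sequence which converges geometrically for `b`: a minimizing sequence of
`φ ↦ b(φ, φ) - 2 ℓ(φ)`. -/
theorem exists_seq_tendsto_of_sq_le {E : Type*} [AddCommGroup E] [Module ℝ E]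
    (b : E →ₗ[ℝ] E →ₗ[ℝ] ℝ) (hs : ∀ φ ψ, b φ ψ = b ψ φ) (h0 : ∀ φ, 0 ≤ b φ φ) (ℓ : E →ₗ[ℝ] ℝ)
    {C : ℝ} (hC : 0 ≤ C) (hℓ : ∀ φ, ℓ φ ^ 2 ≤ C * b φ φ) :
    ∃ ψ : ℕ → E, (∀ n, b (ψ (n + 1) - ψ n) (ψ (n + 1) - ψ n) ≤ (1 / 16) ^ n) ∧
      ∀ φ, Filter.Tendsto (fun n => b φ (ψ n)) Filter.atTop (𝓝 (ℓ φ)) := by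
  let j : E → ℝ := fun φ => b φ φ - 2 * ℓ φ
  have hj : BddBelow (range j) := by
    refine ⟨-C, ?_⟩
    rintro _ ⟨φ, rfl⟩
    have h1 : (2 * ℓ φ) ^ 2 ≤ (b φ φ + C) ^ 2 := by
      nlinarith [hℓ φ, sq_nonneg (b φ φ - C)]
    have h2 := abs_le_of_sq_le_sq h1 (add_nonneg (h0 φ) hC)
    simp only [j]
    linarith [le_abs_self (2 * ℓ φ)]
  have hI : ∀ φ, (⨅ φ, j φ) ≤ j φ := fun φ => ciInf_le hj φ
  set I := ⨅ φ, j φ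
  have hex : ∀ n : ℕ, ∃ ψ, j ψ < I + (1 / 16) ^ n / 4 := fun n =>
    exists_lt_of_ciInf_lt (lt_add_of_pos_right _ (by positivity))
  choose ψ hψ using hex
  refine ⟨ψ, fun n => ?_, fun φ => ?_⟩
  · have h1 := hI ((2⁻¹ : ℝ) • (ψ (n + 1) + ψ n))
    have h2 := hψ n
    have h3 := hψ (n + 1)
    have h4 : (1 / 16 : ℝ) ^ (n + 1) ≤ (1 / 16) ^ n :=
      pow_le_pow_of_le_one (by norm_num) (by norm_num) n.le_succ
    simp only [j, map_smul, map_add, LinearMap.smul_apply, LinearMap.add_apply, smul_eq_mul]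
      at h1 h2 h3
    simp only [map_sub, LinearMap.sub_apply]
    have h5 := hs (ψ (n + 1)) (ψ n)
    linarith
  · rw [tendsto_iff_norm_sub_tendsto_zero]
    have hlim : Filter.Tendsto (fun n : ℕ => (1 / 4 : ℝ) ^ n * (b φ φ + 1)) Filter.atTop
        (𝓝 (0 * (b φ φ + 1))) :=
      (tendsto_pow_atTop_nhds_zero_of_lt_one (by norm_num) (by norm_num)).mul_const _
    rw [zero_mul] at hlim
    refine squeeze_zero (fun n => norm_nonneg _) (fun n => ?_) hlim
    -- minimality at `ψ n`, in the directions `φ` and `-φ` with step `4⁻ⁿ`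
    have hpos : (0 : ℝ) < (1 / 4) ^ n := by positivity
    have h16 : (1 / 16 : ℝ) ^ n = (1 / 4) ^ n * (1 / 4) ^ n := by
      rw [← mul_pow]; norm_num
    set t : ℝ := (1 / 4) ^ n
    have h1 := hI (ψ n + t • φ)
    have h2 := hI (ψ n - t • φ)
    have h3 := hψ n
    rw [h16] at h3
    simp only [j, map_smul, map_add, map_sub, LinearMap.smul_apply, LinearMap.add_apply,
      LinearMap.sub_apply, smul_eq_mul, hs (ψ n) φ] at h1 h2 h3
    rw [Real.norm_eq_abs, abs_le]
    have h4 := h0 φ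
    constructor
    · have : t * (-(t * (b φ φ + 1))) ≤ t * (b φ (ψ n) - ℓ φ) := by nlinarith
      exact le_of_mul_le_mul_left this hpos
    · have : t * (b φ (ψ n) - ℓ φ) ≤ t * (t * (b φ φ + 1)) := by nlinarith
      exact le_of_mul_le_mul_left this hpos

namespace HilbertModuleStructure

variable {X : Type u} [MeasurableSpace X] {μ : Measure X}
  {E : Type u} [NormedAddCommGroup E] [NormedSpace ℝ E] [Module (Linf μ) E]
  (H : HilbertModuleStructure μ E)

theorem add_right (φ ψ ψ' : E) : H.inner φ (ψ + ψ') = H.inner φ ψ + H.inner φ ψ' := by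
  rw [H.symm, H.add_left, H.symm ψ, H.symm ψ']

theorem smul_right (f : Linf μ) (φ ψ : E) : H.inner φ (f • ψ) = f * H.inner φ ψ := by
  rw [H.symm, H.smul_left, H.symm]

theorem real_smul_left (c : ℝ) (φ ψ : E) : H.inner (c • φ) ψ = c • H.inner φ ψ := by
  have := H.isBanachModule.isScalarTower
  rw [← one_smul (Linf μ) φ, ← smul_assoc, H.smul_left, one_smul, smul_mul_assoc, one_mul]

theorem real_smul_right (c : ℝ) (φ ψ : E) : H.inner φ (c • ψ) = c • H.inner φ ψ := by
  rw [H.symm, H.real_smul_left, H.symm]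

/-- The inner product as a real bilinear map. -/
def innerₗ : E →ₗ[ℝ] E →ₗ[ℝ] Linf μ :=
  LinearMap.mk₂ ℝ H.inner H.add_left H.real_smul_left H.add_right H.real_smul_right

theorem innerₗ_apply (φ ψ : E) : H.innerₗ φ ψ = H.inner φ ψ := rfl

theorem norm_inner_le (φ ψ : E) : ‖H.inner φ ψ‖ ≤ ‖φ‖ * ‖ψ‖ := by
  have key : ∀ φ ψ : E, 2 * ‖H.inner φ ψ‖ ≤ ‖φ‖ ^ 2 + ‖ψ‖ ^ 2 := fun φ ψ => by
    have h1 : ∀ φ ψ : E, ∀ᵐ x ∂μ, -(2 * H.inner φ ψ x) ≤ ‖φ‖ ^ 2 + ‖ψ‖ ^ 2 := fun φ ψ => by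
      have e : H.inner (φ + ψ) (φ + ψ)
          = H.inner φ φ + H.inner ψ ψ + (H.inner φ ψ + H.inner φ ψ) := by
        rw [H.add_left, H.add_right, H.add_right, H.symm ψ φ]; abel
      have h2 := Linf.nonneg_iff.1 (e ▸ H.nonneg (φ + ψ))
      filter_upwards [h2, Lp.coeFn_add (H.inner φ φ + H.inner ψ ψ) (H.inner φ ψ + H.inner φ ψ),
        Lp.coeFn_add (H.inner φ φ) (H.inner ψ ψ), Lp.coeFn_add (H.inner φ ψ) (H.inner φ ψ),
        Linf.ae_abs_le_norm (H.inner φ φ), Linf.ae_abs_le_norm (H.inner ψ ψ)]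
        with x k1 k2 k3 k4 k5 k6
      rw [k2, Pi.add_apply, k3, k4, Pi.add_apply, Pi.add_apply] at k1
      rw [H.norm_sq, H.norm_sq]
      linarith [le_abs_self (H.inner φ φ x), le_abs_self (H.inner ψ ψ x)]
    have h3 : H.inner (-φ) ψ = -H.inner φ ψ := by
      rw [← neg_one_smul ℝ φ, H.real_smul_left, neg_one_smul]
    have h4 := h1 (-φ) ψ
    rw [h3, norm_neg] at h4
    have h5 : ‖H.inner φ ψ‖ ≤ (‖φ‖ ^ 2 + ‖ψ‖ ^ 2) / 2 := by
      refine Linf.norm_le_of_ae (by positivity) ?_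
      filter_upwards [h1 φ ψ, h4, Lp.coeFn_neg (H.inner φ ψ)] with x k1 k2 k3
      rw [k3, Pi.neg_apply] at k2
      rw [abs_le]
      constructor <;> linarith
    linarith
  rcases eq_or_ne ‖φ‖ 0 with hφ | hφ
  · rw [norm_eq_zero.1 hφ, ← innerₗ_apply, map_zero, LinearMap.zero_apply]
    simp
  rcases eq_or_ne ‖ψ‖ 0 with hψ | hψ
  · rw [norm_eq_zero.1 hψ, ← innerₗ_apply, map_zero]
    simp
  have h := key (‖ψ‖ • φ) (‖φ‖ • ψ)
  rw [H.real_smul_left, H.real_smul_right] at h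
  simp only [norm_smul, norm_norm] at h
  have hpos : 0 < ‖φ‖ * ‖ψ‖ := by positivity
  refine le_of_mul_le_mul_left ?_ hpos
  nlinarith

/-- The canonical map `ψ ↦ ⟨·, ψ⟩` from a Hilbert module into its dual module. -/
def toDual : E →ₗ[Linf μ] DualModule μ E where
  toFun ψ := DualModule.mk ((H.innerₗ.flip ψ).mkContinuous ‖ψ‖ fun φ => by
    rw [mul_comm]; exact H.norm_inner_le φ ψ) fun f φ => H.smul_left f φ ψ
  map_add' ψ ψ' := DualModule.ext fun φ => H.add_right φ ψ ψ'
  map_smul' f ψ := DualModule.ext fun φ => H.smul_right f φ ψ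

@[simp] theorem toDual_apply (φ ψ : E) : (H.toDual ψ) φ = H.inner φ ψ := rfl

theorem norm_toDual (ψ : E) : ‖H.toDual ψ‖ = ‖ψ‖ := by
  refine le_antisymm (ContinuousLinearMap.opNorm_le_bound _ (norm_nonneg ψ) fun φ => by
    rw [mul_comm]; exact H.norm_inner_le φ ψ) ?_
  have h1 := (H.toDual ψ).norm_apply_le ψ
  rw [toDual_apply, ← H.norm_sq, sq] at h1
  rcases eq_or_ne ‖ψ‖ 0 with hψ | hψ
  · rw [hψ]; exact norm_nonneg _
  · exact le_of_mul_le_mul_right h1 (by positivity)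

theorem toDual_injective : Function.Injective H.toDual := by
  refine (injective_iff_map_eq_zero H.toDual).2 fun ψ h => ?_
  rw [← norm_eq_zero, ← H.norm_toDual, h, norm_zero]

/-- The canonical map as a bounded operator. -/
def toDualCLM : E →L[ℝ] DualModule μ E :=
  LinearMap.mkContinuous
    { toFun := H.toDual
      map_add' := H.toDual.map_add
      map_smul' := fun c ψ => DualModule.ext fun φ => H.real_smul_right c φ ψ } 1
    fun ψ => by rw [one_mul]; exact (H.norm_toDual ψ).le

@[simp] theorem toDualCLM_apply (ψ : E) : H.toDualCLM ψ = H.toDual ψ := rfl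

/-- Over the sets of an increasing sequence which exhausts the space, a bounded module map `Φ` is
represented by elements of the Hilbert module. A sequence `ψ n` represents `Φ` in the Hilbert
space completion for the integrated inner product; by the Borel–Cantelli lemma it converges
uniformly on the sets where all the differences from the `m`-th on are small. -/
theorem exists_local_representation [SFinite μ] {N : E → Linf μ} (hN : IsPointwiseNorm μ N)
    (hH : ∀ φ, H.inner φ φ = N φ * N φ) (Φ : DualModule μ E) :
    ∃ (a : ℕ → Linf μ) (χ : ℕ → E), (∀ m n, m ≤ n → a m * a n = a m) ∧
      (∀ m, ‖a m‖ ≤ 1) ∧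
      (∀ h, (∀ m, a m * h = 0) → h = 0) ∧ ∀ m, a m • Φ = H.toDual (χ m) := by
  have hcomp := H.isBanachModule.complete
  let b : E →ₗ[ℝ] E →ₗ[ℝ] ℝ := H.innerₗ.compr₂ (Linf.mean μ).toLinearMap
  have hb : ∀ φ ψ, b φ ψ = Linf.mean μ (H.inner φ ψ) := fun _ _ => rfl
  let ℓ : E →ₗ[ℝ] ℝ := ((Linf.mean μ) ∘L Φ.1).toLinearMap
  have hℓ : ∀ φ, ℓ φ = Linf.mean μ (Φ φ) := fun _ => rfl
  have hbound : ∀ φ, ℓ φ ^ 2 ≤ (Linf.mean μ 1 * ‖Φ‖ ^ 2) * b φ φ := fun φ => by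
    have h1 : Φ φ * Φ φ ≤ (‖Φ‖ ^ 2) • H.inner φ φ := by
      rw [hH, Linf.le_iff]
      filter_upwards [Φ.ae_abs_apply_le hN φ, Linf.coeFn_mul (Φ φ) (Φ φ),
        Lp.coeFn_smul (‖Φ‖ ^ 2) (N φ * N φ), Linf.coeFn_mul (N φ) (N φ)] with x k1 k2 k3 k4
      rw [k2, k3, Pi.smul_apply, k4, smul_eq_mul, ← abs_mul_abs_self]
      calc |Φ φ x| * |Φ φ x| ≤ (‖Φ‖ * N φ x) * (‖Φ‖ * N φ x) :=
            mul_self_le_mul_self (abs_nonneg _) k1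
        _ = _ := by ring
    calc ℓ φ ^ 2 ≤ Linf.mean μ 1 * Linf.mean μ (Φ φ * Φ φ) := Linf.sq_mean_le _
      _ ≤ Linf.mean μ 1 * Linf.mean μ ((‖Φ‖ ^ 2) • H.inner φ φ) := by
        gcongr
        · exact Linf.mean_nonneg Linf.zero_le_one'
        · exact Linf.mean_mono h1
      _ = _ := by rw [_root_.map_smul, smul_eq_mul, hb]; ring
  obtain ⟨ψ, hψ, hψt⟩ := exists_seq_tendsto_of_sq_le b
    (fun φ ψ => by rw [hb, hb, H.symm]) (fun φ => Linf.mean_nonneg (H.nonneg φ)) ℓ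
    (mul_nonneg (Linf.mean_nonneg Linf.zero_le_one') (sq_nonneg _)) hbound
  let D : ℕ → Linf μ := fun n => H.inner (ψ (n + 1) - ψ n) (ψ (n + 1) - ψ n)
  have hDm : ∀ n, Measurable (D n) := fun n => (Lp.stronglyMeasurable (D n)).measurable
  let S : ℕ → Set X := fun m => {x | ∀ n, m ≤ n → D n x < (1 / 4) ^ n}
  have hSm : ∀ m, MeasurableSet (S m) := fun m => by
    have : S m = ⋂ (n) (_ : m ≤ n), {x | D n x < (1 / 4) ^ n} := by
      ext x; simp [S]
    rw [this]
    exact MeasurableSet.iInter fun n => MeasurableSet.iInter fun _ =>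
      measurableSet_lt (hDm n) measurable_const
  have hS : ∀ᵐ x ∂μ, ∃ m, x ∈ S m := by
    have h1 : ∀ n, μ.toFinite {x | (1 / 4 : ℝ) ^ n ≤ D n x} ≤ ENNReal.ofReal ((1 / 4) ^ n) :=
      fun n => by
        have h2 := mul_meas_ge_le_integral_of_nonneg (μ := μ.toFinite) (f := D n)
          (by
            change ∀ᵐ x ∂_, _
            rw [ae_toFinite]
            exact Linf.nonneg_iff.1 (H.nonneg _)) (Linf.integrable_toFinite _) ((1 / 4) ^ n)
        have h3 : ∫ x, D n x ∂μ.toFinite ≤ (1 / 16) ^ n := hψ n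
        have h16 : (1 / 16 : ℝ) ^ n = (1 / 4) ^ n * (1 / 4) ^ n := by
          rw [← mul_pow]; norm_num
        rw [h16] at h3
        have h4 := le_of_mul_le_mul_left (h2.trans h3) (by positivity : (0 : ℝ) < (1 / 4) ^ n)
        rw [← ofReal_measureReal]
        exact ENNReal.ofReal_le_ofReal h4
    have h2 : ∑' n, μ.toFinite {x | (1 / 4 : ℝ) ^ n ≤ D n x} ≠ ∞ := by
      refine ne_top_of_le_ne_top ?_ (ENNReal.tsum_le_tsum h1)
      rw [← ENNReal.ofReal_tsum_of_nonneg (fun n => by positivity)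
        (summable_geometric_of_lt_one (by norm_num) (by norm_num))]
      exact ENNReal.ofReal_ne_top
    have h3 := ae_eventually_notMem h2
    rw [ae_toFinite] at h3
    filter_upwards [h3] with x hx
    obtain ⟨m, hm⟩ := Filter.eventually_atTop.1 hx
    exact ⟨m, fun n hn => not_le.1 (hm n hn)⟩
  choose a ha haa using fun m => Linf.exists_indicator (μ := μ) (hSm m)
  have hmono : ∀ m n, m ≤ n → S m ⊆ S n := fun m n hmn x hx k hk => hx k (hmn.trans hk)
  have hDa : ∀ m n, m ≤ n → ‖a m • (ψ (n + 1) - ψ n)‖ ≤ (1 / 2) ^ n := fun m n hmn => by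
    refine le_of_sq_le_sq ?_ (by positivity)
    rw [H.norm_sq, H.smul_left, H.smul_right, ← mul_assoc, haa]
    have h4 : ((1 / 2 : ℝ) ^ n) ^ 2 = (1 / 4) ^ n := by
      rw [← pow_mul, mul_comm, pow_mul]; norm_num
    rw [h4]
    refine Linf.norm_le_of_ae (by positivity) ?_
    filter_upwards [Linf.coeFn_mul (a m) (D n), ha m, Linf.nonneg_iff.1 (H.nonneg _ : 0 ≤ D n)]
      with x k1 k2 k3
    rw [k1, k2]
    by_cases hx : x ∈ S m
    · rw [indicator_of_mem hx, one_mul, abs_of_nonneg k3]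
      exact (hx n hmn).le
    · rw [indicator_of_notMem hx, zero_mul, abs_zero]
      positivity
  have hcauchy : ∀ m, CauchySeq fun n => a m • ψ (n + m) := fun m => by
    refine cauchySeq_of_le_geometric (1 / 2) 1 (by norm_num) fun n => ?_
    rw [dist_comm, dist_eq_norm, ← smul_sub, add_right_comm, one_mul]
    exact (hDa m (n + m) (Nat.le_add_left m n)).trans
      (pow_le_pow_of_le_one (by norm_num) (by norm_num) (Nat.le_add_right n m))
  choose χ hχ using fun m => cauchySeq_tendsto_of_complete (hcauchy m)
  refine ⟨a, χ, fun m n hmn => ?_, fun m => ?_, fun h hh => ?_, fun m => ?_⟩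
  · rw [Linf.ext_iff]
    filter_upwards [ha m, ha n, Linf.coeFn_mul (a m) (a n)] with x h1 h2 h3
    rw [h3, h1, h2]
    by_cases hx : x ∈ S m
    · simp [hx, hmono m n hmn hx]
    · simp [hx]
  · refine Linf.norm_le_of_ae zero_le_one ?_
    filter_upwards [ha m] with x hx
    rw [hx]
    by_cases hx : x ∈ S m <;> simp [hx]
  · rw [Linf.eq_zero_iff]
    have h1 : ∀ᵐ x ∂μ, ∀ m, (S m).indicator (fun _ => (1 : ℝ)) x * h x = 0 := by
      rw [ae_all_iff]
      intro m
      filter_upwards [Linf.eq_zero_iff.1 (hh m), Linf.coeFn_mul (a m) h, ha m] with x k1 k2 k3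
      rw [← k3, ← k2, k1]
    filter_upwards [hS, h1] with x ⟨m, hm⟩ h2
    simpa [hm] using h2 m
  · refine DualModule.ext fun φ => ?_
    rw [DualModule.smul_apply, toDual_apply]
    -- test against all `h` in `L^∞`
    have key : ∀ h : Linf μ, Linf.mean μ (h * H.inner φ (χ m)) = Linf.mean μ (h * (a m * Φ φ)) :=
      fun h => by
        have h1 : Filter.Tendsto (fun n => b ((h * a m) • φ) (ψ (n + m))) Filter.atTop
            (𝓝 (ℓ ((h * a m) • φ))) :=
          (hψt _).comp (Filter.tendsto_add_atTop_nat m)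
        have h2 : Filter.Tendsto (fun n => H.toDual (a m • ψ (n + m)) φ) Filter.atTop
            (𝓝 (H.toDual (χ m) φ)) := by
          have h3 : Filter.Tendsto (fun n => H.toDualCLM (a m • ψ (n + m))) Filter.atTop
              (𝓝 (H.toDualCLM (χ m))) := (H.toDualCLM.continuous.tendsto _).comp (hχ m)
          exact ((DualModule.eval φ).1.continuous.tendsto _).comp h3
        have h4 : Filter.Tendsto (fun n => Linf.mean μ (h * H.toDual (a m • ψ (n + m)) φ))
            Filter.atTop (𝓝 (Linf.mean μ (h * H.toDual (χ m) φ))) :=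
          ((Linf.mean μ).continuous.tendsto _).comp (h2.const_mul h)
        refine tendsto_nhds_unique h4 ?_
        rw [hℓ, Φ.map_smul, mul_assoc] at h1
        refine h1.congr fun n => ?_
        rw [hb, H.smul_left, toDual_apply, H.smul_right, mul_assoc]
    refine (sub_eq_zero.1 (Linf.eq_zero_of_mean_mul_self ?_)).symm
    rw [mul_sub, map_sub, key, sub_self]

/-- The dual of a Hilbert module is reflexive. -/
theorem isReflexiveModule_dual [SFinite μ] {N : E → Linf μ} (hN : IsPointwiseNorm μ N)
    (hH : ∀ φ, H.inner φ φ = N φ * N φ) : IsReflexiveModule μ (DualModule μ E) := by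
  refine DualModule.isReflexiveModule fun Ψ h hh => ?_
  have hcomp : ∀ (f : Linf μ) (φ : E), (Ψ.1 ∘L H.toDualCLM) (f • φ)
      = f * (Ψ.1 ∘L H.toDualCLM) φ := fun f φ => by
    rw [ContinuousLinearMap.comp_apply, toDualCLM_apply, _root_.map_smul]
    exact Ψ.map_smul f _
  let Φ₀ : DualModule μ E := DualModule.mk (Ψ.1 ∘L H.toDualCLM) hcomp
  have hΦ₀ : ∀ φ, Φ₀ φ = Ψ (H.toDual φ) := fun _ => rfl
  obtain ⟨a, χ, -, -, ha0, ha⟩ := H.exists_local_representation hN hH Φ₀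
  obtain ⟨m, hm⟩ : ∃ m, a m * h ≠ 0 := by
    by_contra! hc
    exact hh (ha0 h hc)
  refine ⟨a m, χ m, hm, DualModule.ext fun Φ => ?_⟩
  obtain ⟨c, ξ, -, -, hc0, hc⟩ := H.exists_local_representation hN hH Φ
  refine sub_eq_zero.1 (hc0 _ fun k => ?_)
  have h1 : c k * (a m * Ψ Φ) = H.inner (ξ k) (χ m) := by
    rw [mul_left_comm, ← Ψ.map_smul, hc, ← hΦ₀, ← DualModule.smul_apply, ha, toDual_apply]
  have h2 : c k * Φ (χ m) = H.inner (χ m) (ξ k) := by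
    rw [← DualModule.smul_apply, hc, toDual_apply]
  rw [mul_sub, DualModule.smul_apply, h1, DualModule.eval_apply, h2, H.symm, sub_self]

/-- The canonical map of a self-dual Hilbert module onto its dual module. -/
def toDualEquiv (hH : H.IsSelfDual) : E ≃ₗ[Linf μ] DualModule μ E :=
  LinearEquiv.ofBijective H.toDual ⟨H.toDual_injective, fun Φ => by
    obtain ⟨ψ, hψ⟩ := hH Φ
    exact ⟨ψ, DualModule.ext fun φ => (hψ φ).symm⟩⟩

theorem toDualEquiv_apply (hH : H.IsSelfDual) (ψ : E) : H.toDualEquiv hH ψ = H.toDual ψ := rfl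

/-- The inner product on the dual of a self-dual Hilbert module which is transported from this
module. -/
def dual [SFinite μ] (hH : H.IsSelfDual) : HilbertModuleStructure μ (DualModule μ E) where
  isBanachModule := DualModule.isBanachModule
  inner Φ Ψ := H.inner ((H.toDualEquiv hH).symm Φ) ((H.toDualEquiv hH).symm Ψ)
  symm _ _ := H.symm _ _
  add_left _ _ _ := by rw [map_add, H.add_left]
  smul_left _ _ _ := by rw [_root_.map_smul, H.smul_left]
  nonneg _ := H.nonneg _
  norm_sq Φ := by
    rw [← H.norm_sq, ← H.norm_toDual, ← H.toDualEquiv_apply hH, LinearEquiv.apply_symm_apply]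

theorem dual_inner [SFinite μ] (hH : H.IsSelfDual) (φ ψ : E) :
    (H.dual hH).inner (H.toDualEquiv hH φ) (H.toDualEquiv hH ψ) = H.inner φ ψ := by
  change H.inner ((H.toDualEquiv hH).symm _) ((H.toDualEquiv hH).symm _) = _
  rw [LinearEquiv.symm_apply_apply, LinearEquiv.symm_apply_apply]

theorem isSelfDual_dual [SFinite μ] (hH : H.IsSelfDual) : (H.dual hH).IsSelfDual := by
  intro Θ
  obtain ⟨ψ, hψ⟩ := hH (DualModule.mk (Θ.1 ∘L H.toDualCLM) fun f φ => by
    rw [ContinuousLinearMap.comp_apply, toDualCLM_apply, _root_.map_smul]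
    exact Θ.map_smul f _)
  refine ⟨H.toDualEquiv hH ψ, fun Φ => ?_⟩
  obtain ⟨φ, rfl⟩ := (H.toDualEquiv hH).surjective Φ
  rw [H.dual_inner]
  exact hψ φ

theorem exists_dual_of_isSelfDual [SFinite μ] (hH : H.IsSelfDual) :
    ∃ (K : HilbertModuleStructure μ (DualModule μ E)) (J : E ≃ₗ[Linf μ] DualModule μ E),
      K.IsSelfDual ∧ (∀ φ ψ : E, J ψ φ = H.inner φ ψ) ∧ (∀ φ : E, ‖J φ‖ = ‖φ‖) ∧
      ∀ φ ψ : E, K.inner (J φ) (J ψ) = H.inner φ ψ :=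
  ⟨H.dual hH, H.toDualEquiv hH, H.isSelfDual_dual hH, fun _ _ => rfl, H.norm_toDual,
    H.dual_inner hH⟩

end HilbertModuleStructure

namespace MeasurablePseudometric.VectorFields

variable {X : Type u} [MeasurableSpace X] {μ : Measure X} {d : MeasurablePseudometric μ}

/-- A Hilbert module of vector fields is self-dual: the local representatives of a bounded module
map are bounded, and their limit along an ultrafilter represents it globally. -/
theorem isSelfDual [SigmaFinite μ] (H : HilbertModuleStructure μ d.VectorFields)
    {N : d.VectorFields → Linf μ} (hN : IsPointwiseNorm μ N)
    (hH : ∀ φ, H.inner φ φ = N φ * N φ) : H.IsSelfDual := by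
  intro Φ
  obtain ⟨a, χ, hmono, ha1, ha0, ha⟩ := H.exists_local_representation hN hH Φ
  have hχ : ∀ m, ‖χ m‖ ≤ ‖Φ‖ := fun m => by
    rw [← H.norm_toDual, ← ha]
    exact (Φ.norm_smul_le _).trans (mul_le_of_le_one_left (norm_nonneg _) (ha1 m))
  obtain ⟨χ', -, hχ'⟩ := exists_ultrafilter_limit (H.isReflexiveModule_dual hN hH)
    (Filter.hyperfilter ℕ) χ (norm_nonneg Φ) (Filter.Eventually.of_forall hχ)
  have hloc : ∀ m, a m • χ' = χ m := fun m => by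
    have hev : ∀ n, m ≤ n → a m • χ n = χ m := fun n hn => H.toDual_injective <| by
      rw [_root_.map_smul, ← ha, ← ha, smul_smul, hmono m n hn]
    refine ext fun f => Linf.pairing_ext fun g => ?_
    rw [smul_apply, Linf.pairing_mul]
    refine tendsto_nhds_unique (hχ' f _) (tendsto_const_nhds.congr' ?_)
    have h1 : ∀ᶠ n in Filter.hyperfilter ℕ, m ≤ n :=
      (Nat.hyperfilter_le_atTop) (Filter.eventually_ge_atTop m)
    filter_upwards [h1] with n hn
    rw [← Linf.pairing_mul, ← smul_apply, hev n hn]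
  refine ⟨χ', fun φ => sub_eq_zero.1 (ha0 _ fun m => ?_)⟩
  rw [mul_sub, ← H.smul_right, hloc, ← DualModule.smul_apply, ha, H.toDual_apply, sub_self]

end MeasurablePseudometric.VectorFields

end

theorem corollary24 {X : Type u} [MeasurableSpace X] (μ : Measure X) [SigmaFinite μ]
    (d : MeasurablePseudometric μ) (hd : d.IsMeasurableMetric) :
    (IsReflexiveModule μ d.OneForms → IsAbelianWStarModule μ d.VectorFields) ∧
    (d.VectorFieldsFinitelyGenerated →
      IsReflexiveModule μ d.OneForms ∧ IsAbelianWStarModule μ d.VectorFields) ∧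
    (ParallelogramLaw μ d.VectorFields →
      IsReflexiveModule μ d.OneForms ∧ IsAbelianWStarModule μ d.VectorFields ∧
      ∃ (H : HilbertModuleStructure μ d.VectorFields) (K : HilbertModuleStructure μ d.OneForms)
        (J : d.VectorFields ≃ₗ[Linf μ] d.OneForms),
        H.IsSelfDual ∧ K.IsSelfDual ∧
        (∀ φ ψ : d.VectorFields, J ψ φ = H.inner φ ψ) ∧
        (∀ φ : d.VectorFields, ‖J φ‖ = ‖φ‖) ∧
        (∀ φ ψ : d.VectorFields, K.inner (J φ) (J ψ) = H.inner φ ψ)) := by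
  have hW := fun hR : IsReflexiveModule μ d.OneForms =>
    MeasurablePseudometric.VectorFields.isAbelianWStarModule hR
  refine ⟨hW, fun hF => ?_, fun hP => ?_⟩
  · have hR := MeasurablePseudometric.VectorFields.isReflexiveModule_of_finitelyGenerated hF
    exact ⟨hR, hW hR⟩
  have hN := MeasurablePseudometric.VectorFields.isPointwiseNorm (d := d)
  have hE := MeasurablePseudometric.VectorFields.isBanachModule (d := d)
  obtain ⟨H, hH⟩ := hP.exists_hilbertModuleStructure hE hN
  have hR : IsReflexiveModule μ d.OneForms := H.isReflexiveModule_dual hN hH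
  have hS := MeasurablePseudometric.VectorFields.isSelfDual H hN hH
  obtain ⟨K, J, h⟩ := H.exists_dual_of_isSelfDual hS
  exact ⟨hR, hW hR, H, K, J, hS, h⟩
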